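/- Let $\rho_1,\dots,\rho_N$ be density matrices on $\mathbb C^d$ and let $p_1,\dots,p_N>0$ with $\sum_i p_i=1$. Put $\mathcal M_{HS}^2(\rho)=\sum_{i,j=1}^N p_ip_j\,\mathrm{Tr}[(\rho_i-\rho_j)^2]$, and let $\mu>0$. For $\vec m=(m_1,\dots,m_N)\in\mathbb Z_{\ge 0}^N$ let $\mathcal H_{\vec m}=\bigotimes_{i=1}^N(\mathbb C^d)^{\otimes m_i}$ and $\rho^{\vec m}=\bigotimes_{i=1}^N\rho_i^{\otimes m_i}$. Let $\mathcal O_{ij}$ be the average of all transpositions that exchange one of the $m_i$ tensor factors of group $i$ with a different one of the $m_j$ tensor factors of group $j$ ($i=j$ allowed; $\mathcal O_{ij}:=0$ if there is none), and let $$\mathcal D^{\vec m}=\sum_{i\ne j}\Big(\frac{m_i(m_i-1)}{\mu^2p_i}\,p_j\,\mathcal O_{ii}+\frac{m_j(m_j-1)}{\mu^2p_j}\,p_i\,\mathcal O_{jj}-2\,\frac{m_im_j}{\mu^2}\,\mathcal O_{ij}\Big),$$ the sum being over ordered pairs. For $M\ge 0$ consider, on $\bigoplus_{m_1+\dots+m_N=M}|\vec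 m\rangle\otimes\mathcal H_{\vec m}$, the state and the observable $$\rho^{(M)}=\sum_{m_1+\dots+m_N=M}\frac{M!}{m_1!\cdots m_N!}\,p_1^{m_1}\cdots p_N^{m_N}\,|\vec m\rangle\langle\vec m|\otimes\rho^{\vec m},\qquad \mathcal D_M=\sum_{m_1+\dots+m_N=M}|\vec m\rangle\langle\vec m|\otimes\mathcal D^{\vec m}.$$ Let $\Gamma_M$ be the set of eigenvalues of $\mathcal D_M$ and, for $x\in\Gamma_M$, let $P^{(M)}_x=\mathrm{Tr}[\Pi^{(M)}_x\rho^{(M)}]$, where $\Pi^{(M)}_x$ is the orthogonal projection onto the eigenspace of $\mathcal D_M$ at $x$. The Poissonized estimator $\mathcal D$ with mean parameter $\mu$ outputs $X\in\Gamma=\bigcup_{M\ge0}\Gamma_M$ with probability $$P_X=\sum_{M\ge 0:\,X\in\Gamma_M}e^{-\mu}\frac{\mu^M}{M!}\,P^{(M)}_X .$$ Proposition. There is an absolute constant $C>0$ such that, for all $N$, $d$, $(p_i)$, $(\rho_i)$ and all $\mu>0$ as above, the series $\mathbb E[\mathcal D]=\sum_{X\in\Gamma}X\,P_X$ and $\mathrm{Var}[\mathcal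 D]=\sum_{X\in\Gamma}P_X\,(X-\mathbb E[\mathcal D])^2$ converge absolutely, and $$\mathrm{Var}[\mathcal D]\le C\,\frac{N}{\mu^2}+\frac{16\,\mathcal M_{HS}^2(\rho)}{\mu}.$$ -/

import Mathlib

open scoped Matrix Nat ComplexOrder

noncomputable section

namespace IdentityTest

/-- A collection of `N` quantum states on `ℂ^d`, the `i`-th one appearing with probability
`prob i > 0`; it describes the density matrix `∑ i, p_i |i⟩⟨i| ⊗ ρ_i`. -/
structure Ensemble (N d : ℕ) where
  prob : Fin N → ℝ
  prob_pos : ∀ i, 0 < prob i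
  prob_sum : ∑ i, prob i = 1
  state : Fin N → Matrix (Fin d) (Fin d) ℂ
  state_posSemidef : ∀ i, (state i).PosSemidef
  state_trace : ∀ i, (state i).trace = 1

variable {N d : ℕ}

/-- Hilbert–Schmidt distance `‖A - B‖₂ = √(Tr[(A - B)† (A - B)])`. -/
def hsDist (A B : Matrix (Fin d) (Fin d) ℂ) : ℝ :=
  Real.sqrt (((A - B)ᴴ * (A - B)).trace.re)

/-- Mean (root mean squared) Hilbert–Schmidt distance of the collection. -/
def meanHS (E : Ensemble N d) : ℝ :=
  Real.sqrt (∑ i, ∑ j, E.prob i * E.prob j * hsDist (E.state i) (E.state j) ^ 2)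

/-- The quantum registers when `m i` copies of the `i`-th state are present. -/
abbrev Site (m : Fin N → ℕ) : Type := Σ i : Fin N, Fin (m i)

/-- Labels of the product basis of `⨂ i, (ℂ^d)^{⊗ m i}`. -/
abbrev Config (d : ℕ) (m : Fin N → ℕ) : Type := Site m → Fin d

/-- The product state `⨂ i, ρ_i^{⊗ m i}`, by its entries in the product basis. -/
def productState (E : Ensemble N d) (m : Fin N → ℕ) :
    Matrix (Config d m) (Config d m) ℂ :=
  Matrix.of fun x y => ∏ s : Site m, E.state s.1 (x s) (y s)

/-- The unitary on `⨂ i, (ℂ^d)^{⊗ m i}` permuting the registers by `τ`. -/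
def permOp {m : Fin N → ℕ} (d : ℕ) (τ : Equiv.Perm (Site m)) :
    Matrix (Config d m) (Config d m) ℂ :=
  Matrix.of fun x y => if x = y ∘ τ then 1 else 0

open scoped Classical in
/-- All transpositions exchanging a register of the `i`-th group with a (different) register of
the `j`-th group; `i = j` is allowed. -/
def transpositions (m : Fin N → ℕ) (i j : Fin N) : Finset (Equiv.Perm (Site m)) :=
  Finset.univ.filter fun τ => ∃ (a : Fin (m i)) (b : Fin (m j)),
    (⟨i, a⟩ : Site m) ≠ ⟨j, b⟩ ∧ τ = Equiv.swap (⟨i, a⟩ : Site m) ⟨j, b⟩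

/-- `O_{ij}`: the average of the transpositions between the groups `i` and `j` (zero if there are
none, in which case its coefficient in `pairObs` vanishes). -/
def avgSwap (d : ℕ) (m : Fin N → ℕ) (i j : Fin N) : Matrix (Config d m) (Config d m) ℂ :=
  ((transpositions m i j).card : ℂ)⁻¹ • ∑ τ ∈ transpositions m i j, permOp d τ

/-- `D_{ij}^{m_i, m_j}`. -/
def pairObs (d : ℕ) (p : Fin N → ℝ) (μ : ℝ) (m : Fin N → ℕ) (i j : Fin N) :
    Matrix (Config d m) (Config d m) ℂ :=
  (m i * (m i - 1) / (μ ^ 2 * p i) * p j : ℝ) • avgSwap d m i i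
    + (m j * (m j - 1) / (μ ^ 2 * p j) * p i : ℝ) • avgSwap d m j j
    - (2 * (m i * m j / μ ^ 2) : ℝ) • avgSwap d m i j

/-- `D^{m}`: the sum of `D_{ij}` over all ordered pairs `i ≠ j`. -/
def typeObs (d : ℕ) (p : Fin N → ℝ) (μ : ℝ) (m : Fin N → ℕ) :
    Matrix (Config d m) (Config d m) ℂ :=
  ∑ i, ∑ j ∈ Finset.univ.filter (fun j => i ≠ j), pairObs d p μ m i j

/-- The vectors `m` of `N` natural numbers with sum `M`. -/
abbrev Types (N M : ℕ) : Type :=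
  {m : Fin N → ℕ // m ∈ Finset.piAntidiag Finset.univ M}

/-- Labels of the basis `|m⟩ ⊗ |x⟩` of the space `⨁ m, |m⟩ ⊗ ⨂ i, (ℂ^d)^{⊗ m i}`. -/
abbrev Basis (N d M : ℕ) : Type := Σ m : Types N M, Config d m.1

/-- `ρ^{(M)} = ∑ m, Multinomial(m) |m⟩⟨m| ⊗ ⨂ i, ρ_i^{⊗ m i}`. -/
def sampleState (E : Ensemble N d) (M : ℕ) : Matrix (Basis N d M) (Basis N d M) ℂ :=
  Matrix.blockDiagonal' fun m : Types N M =>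
    (Nat.multinomial Finset.univ m.1 * ∏ i, E.prob i ^ m.1 i : ℝ) • productState E m.1

/-- `D_M = ∑ m, |m⟩⟨m| ⊗ D^{m}`. -/
def sampleObs (d : ℕ) (p : Fin N → ℝ) (μ : ℝ) (M : ℕ) :
    Matrix (Basis N d M) (Basis N d M) ℂ :=
  Matrix.blockDiagonal' fun m : Types N M => typeObs d p μ m.1

section Measurement

variable {n : Type*} [Fintype n] [DecidableEq n]

/-- The (real) eigenvalues of an observable. -/
def eigenvalueSet (A : Matrix n n ℂ) : Set ℝ :=
  {x | Module.End.HasEigenvalue (Matrix.toEuclideanLin A) (x : ℂ)}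

/-- Born rule: the probability `Tr[Π_x σ]` of the outcome `x` when the observable `A` is measured
on the state `σ`, where `Π_x` is the orthogonal projection onto the eigenspace of `A` at `x`. -/
def bornProb (A σ : Matrix n n ℂ) (x : ℝ) : ℝ :=
  (LinearMap.trace ℂ (EuclideanSpace ℂ n)
    ((Module.End.eigenspace (Matrix.toEuclideanLin A) (x : ℂ)).starProjection.toLinearMap ∘ₗ
      Matrix.toEuclideanLin σ)).re

end Measurement

/-- The Poisson weight `e^{-μ} μ^M / M!`. -/
def poi (μ : ℝ) (M : ℕ) : ℝ := Real.exp (-μ) * μ ^ M / M !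

/-- `Γ`: the possible outputs of the Poissonized estimator. -/
def outcomes (E : Ensemble N d) (μ : ℝ) : Set ℝ :=
  ⋃ M : ℕ, eigenvalueSet (sampleObs d E.prob μ M)

open scoped Classical in
/-- `P_X`: the probability that the Poissonized estimator outputs `X`. -/
def outProb (E : Ensemble N d) (μ : ℝ) (X : ℝ) : ℝ :=
  ∑' M : ℕ, poi μ M *
    (if X ∈ eigenvalueSet (sampleObs d E.prob μ M) then
      bornProb (sampleObs d E.prob μ M) (sampleState E M) X else 0)

/-- `𝔼[D] = ∑_{X ∈ Γ} X P_X`. -/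
def estMean (E : Ensemble N d) (μ : ℝ) : ℝ :=
  ∑' X : outcomes E μ, (X : ℝ) * outProb E μ X

/-- `Var[D] = ∑_{X ∈ Γ} P_X (X - 𝔼[D])²`. -/
def estVar (E : Ensemble N d) (μ : ℝ) : ℝ :=
  ∑' X : outcomes E μ, outProb E μ X * ((X : ℝ) - estMean E μ) ^ 2

end IdentityTest

end

/-! Collecting coefficients, `typeObs` is `2 / μ²` times the sum over ordered pairs of distinct
registers `s, t` of `δ_{ij} / p_i - 1` times the swap of `s` and `t`, where `i, j` are the groups of
`s, t` (`typeObs_eq`). The multinomial weights say that the `M` registers carry independent labels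
drawn from `p`. The estimator is therefore a U-statistic on copies of `∑ i, p_i |i⟩⟨i| ⊗ ρ_i`, and
its moments are computed by counting overlaps of register pairs (`sum_sum_swapPairMean`).

With `ρ̄ = ∑ i, p_i ρ_i`, one pair has expectation `S = ∑ j, p_j Tr (ρ_j - ρ̄)²`, half of the
squared mean distance (`swapMean_eq`, `meanHS_sq`). Two pairs give `S²` if disjoint, `T = ∑ j, p_j
Tr ρ_j (ρ_j - ρ̄)²` if they share one register (`cycleMean_eq`), and `N - 1` if they coincide,
because the swaps cancel (`squareMean_eq`).

The numbers of configurations are descending factorials of `M`, whose Poisson means are powers of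
`μ`. Hence the mean is `2 S` and the second moment is `4 S² + 16 T / μ + 8 (N - 1) / μ²`: the
disjoint term cancels against the squared mean. Finally `T ≤ S`, since a density matrix has
eigenvalues at most one. -/

namespace IdentityTest

/-! ### Moments of a projective measurement -/

section Measurement

variable {n : Type*} [Fintype n] [DecidableEq n] {A : Matrix n n ℂ}

/-- The weight of the `i`-th eigenvector of `A` in the state `σ`. -/
noncomputable def eigenWeight (hA : A.IsHermitian) (σ : Matrix n n ℂ) (i : n) : ℝ :=
  (inner ℂ (hA.eigenvectorBasis i) (Matrix.toEuclideanLin σ (hA.eigenvectorBasis i))).re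

lemma toEuclideanLin_eigenvectorBasis (hA : A.IsHermitian) (i : n) :
    Matrix.toEuclideanLin A (hA.eigenvectorBasis i) =
      (hA.eigenvalues i : ℂ) • hA.eigenvectorBasis i := by
  have h := hA.mulVec_eigenvectorBasis i
  apply (WithLp.ofLp_injective 2)
  simpa [Matrix.toLpLin_apply] using! h

lemma eigenvalues_mem_eigenvalueSet (hA : A.IsHermitian) (i : n) :
    hA.eigenvalues i ∈ eigenvalueSet A := by
  refine Module.End.hasEigenvalue_of_hasEigenvector (x := hA.eigenvectorBasis i) ?_
  rw [Module.End.hasEigenvector_iff, Module.End.mem_eigenspace_iff]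
  exact ⟨toEuclideanLin_eigenvectorBasis hA i, by
    simpa using hA.eigenvectorBasis.toBasis.ne_zero i⟩

lemma eigenWeight_nonneg (hA : A.IsHermitian) {σ : Matrix n n ℂ} (hσ : σ.PosSemidef) (i : n) :
    0 ≤ eigenWeight hA σ i := by
  have h := (Matrix.isPositive_toEuclideanLin_iff.mpr hσ).re_inner_nonneg_right
    (hA.eigenvectorBasis i)
  exact h

lemma starProjection_eigenvectorBasis (hA : A.IsHermitian) (x : ℝ) (i : n) :
    (Module.End.eigenspace (Matrix.toEuclideanLin A) (x : ℂ)).starProjection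
        (hA.eigenvectorBasis i) =
      if hA.eigenvalues i = x then hA.eigenvectorBasis i else 0 := by
  have hi := Module.End.mem_eigenspace_iff.mpr (toEuclideanLin_eigenvectorBasis hA i)
  split_ifs with h
  · rw [Submodule.starProjection_eq_self_iff, ← h]
    exact hi
  · rw [Submodule.starProjection_apply_eq_zero_iff, Submodule.mem_orthogonal]
    intro u hu
    exact (Matrix.isSymmetric_toEuclideanLin_iff.mpr hA).orthogonalFamily_eigenspaces
      (i := (x : ℂ)) (j := (hA.eigenvalues i : ℂ)) (fun h' => h (by exact_mod_cast h'.symm))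
      ⟨u, hu⟩ ⟨_, hi⟩

/-- Taking the trace in an eigenbasis of `A`, the projection keeps exactly the eigenvectors with
eigenvalue `x`. Measuring `A` thus amounts to sampling an eigenvector and reporting its eigenvalue.
-/
lemma bornProb_eq_sum (hA : A.IsHermitian) (σ : Matrix n n ℂ) (x : ℝ) :
    bornProb A σ x = ∑ i, if hA.eigenvalues i = x then eigenWeight hA σ i else 0 := by
  rw [bornProb, LinearMap.trace_eq_sum_inner _ hA.eigenvectorBasis, Complex.re_sum]
  refine Finset.sum_congr rfl fun i _ => ?_
  rw [LinearMap.comp_apply, ContinuousLinearMap.coe_coe,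
    ← Submodule.inner_starProjection_left_eq_right, starProjection_eigenvectorBasis]
  split_ifs
  · rfl
  · simp

/-- Makes the membership test in `outProb` redundant. -/
lemma bornProb_eq_zero_of_notMem (A σ : Matrix n n ℂ) {x : ℝ} (hx : x ∉ eigenvalueSet A) :
    bornProb A σ x = 0 := by
  have h : Module.End.eigenspace (Matrix.toEuclideanLin A) (x : ℂ) = ⊥ := by
    by_contra h
    exact hx (Module.End.hasEigenvalue_iff.mpr h)
  simp [bornProb, h]

lemma trace_pow_mul_eq_sum (hA : A.IsHermitian) (σ : Matrix n n ℂ) (k : ℕ) :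
    (A ^ k * σ).trace.re = ∑ i, hA.eigenvalues i ^ k * eigenWeight hA σ i := by
  have h : (A ^ k * σ).trace = LinearMap.trace ℂ (EuclideanSpace ℂ n)
      (Matrix.toEuclideanLin (σ * A ^ k)) := by
    rw [Matrix.trace_mul_comm, Matrix.toEuclideanLin, Matrix.toLpLin_eq_toLin,
      Matrix.trace_toLin_eq]
  have hpow : ∀ i, Matrix.toEuclideanLin (A ^ k) (hA.eigenvectorBasis i) =
      ((hA.eigenvalues i : ℂ) ^ k) • hA.eigenvectorBasis i := by
    intro i
    clear h
    induction k with
    | zero => simp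
    | succ k ih =>
      rw [pow_succ, Matrix.toLpLin_mul_same, LinearMap.comp_apply,
        toEuclideanLin_eigenvectorBasis, map_smul, ih, smul_smul, pow_succ, mul_comm]
  rw [h, LinearMap.trace_eq_sum_inner _ hA.eigenvectorBasis, Complex.re_sum]
  refine Finset.sum_congr rfl fun i _ => ?_
  rw [Matrix.toLpLin_mul_same, LinearMap.comp_apply, hpow, map_smul, inner_smul_right,
    ← Complex.ofReal_pow, Complex.re_ofReal_mul, eigenWeight]

end Measurement

/-! ### Distribution of the outcomes -/

section Fibers

variable {ι : Type*}

open scoped Classical in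
/-- Summing a function of the outcome against the distribution of the outcomes. -/
lemma hasSum_outcome_mul {Γ : Set ℝ} {val wt : ι → ℝ} (hΓ : ∀ i, val i ∈ Γ)
    (h : ℝ → ℝ) (hs : Summable fun i => h (val i) * wt i) :
    HasSum (fun X : Γ => h X * ∑' i, if val i = X then wt i else 0)
      (∑' i, h (val i) * wt i) := by
  let f : ι → Γ := fun i => ⟨val i, hΓ i⟩
  have hs' := (Equiv.sigmaFiberEquiv f).hasSum_iff.mpr hs.hasSum
  have hsum := hs'.summable
  refine hs'.sigma fun X => ?_
  have h1 := (hsum.sigma_factor X).hasSum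
  convert! h1 using 1
  rw [← tsum_mul_left, ← tsum_subtype_eq_of_support_subset (s := {i | f i = X})]
  · refine tsum_congr fun i => ?_
    obtain ⟨i, rfl⟩ := i
    simp [f]
  · intro i hi
    simp only [Function.mem_support, ne_eq, mul_eq_zero, not_or] at hi
    by_contra hne
    exact hi.2 (if_neg fun h => hne (Subtype.ext h))

end Fibers

section Estimator

variable {N d : ℕ}

lemma poi_nonneg {μ : ℝ} (hμ : 0 < μ) (M : ℕ) : 0 ≤ poi μ M := by
  unfold poi; positivity

/-- The mean and the variance of the estimator from the moments of the observables. -/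
lemma estimator_of_moments (E : Ensemble N d) {μ : ℝ} (hμ : 0 < μ)
    (hD : ∀ M, (sampleObs d E.prob μ M).IsHermitian)
    (hρ : ∀ M, (sampleState E M).PosSemidef) {e₁ e₂ : ℝ}
    (h0 : HasSum (fun M => poi μ M * (sampleState E M).trace.re) 1)
    (h1 : HasSum (fun M => poi μ M * (sampleObs d E.prob μ M * sampleState E M).trace.re) e₁)
    (h2 : HasSum (fun M => poi μ M * (sampleObs d E.prob μ M ^ 2 * sampleState E M).trace.re) e₂) :
    Summable (fun X : outcomes E μ => (X : ℝ) * outProb E μ X) ∧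
    Summable (fun X : outcomes E μ => outProb E μ X * ((X : ℝ) - estMean E μ) ^ 2) ∧
      estVar E μ = e₂ - e₁ ^ 2 := by
  let val : (Σ M, Basis N d M) → ℝ := fun i => (hD i.1).eigenvalues i.2
  let wt : (Σ M, Basis N d M) → ℝ := fun i =>
    poi μ i.1 * eigenWeight (hD i.1) (sampleState E i.1) i.2
  have hwt : ∀ i, 0 ≤ wt i := fun i =>
    mul_nonneg (poi_nonneg hμ _) (eigenWeight_nonneg (hD i.1) (hρ i.1) i.2)
  have fib : ∀ k M, ∑ b, val ⟨M, b⟩ ^ k * wt ⟨M, b⟩ =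
      poi μ M * (sampleObs d E.prob μ M ^ k * sampleState E M).trace.re := by
    intro k M
    rw [trace_pow_mul_eq_sum (hD M), Finset.mul_sum]
    exact Finset.sum_congr rfl fun b _ => by simp only [val, wt]; ring
  -- Even powers make all terms nonnegative, so summability over pairs of a block and an eigenvector
  -- follows from that of the block sums.
  have sm : ∀ k e, Even k → HasSum (fun M => poi μ M *
      (sampleObs d E.prob μ M ^ k * sampleState E M).trace.re) e →
      Summable fun i => val i ^ k * wt i := by
    intro k e hk h
    refine (summable_sigma_of_nonneg fun i => mul_nonneg (hk.pow_nonneg _) (hwt i)).mpr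
      ⟨fun M => (hasSum_fintype _).summable, ?_⟩
    simpa only [tsum_fintype, fib] using h.summable
  have hs0 : Summable wt := by
    have h := sm 0 1 (by decide)
    simp only [pow_zero, one_mul] at h
    exact h h0
  have hs2 : Summable fun i => val i ^ 2 * wt i := sm 2 e₂ (by decide) h2
  have hs1 : Summable fun i => val i * wt i := by
    -- The odd moment is dominated through `|x| ≤ 1 + x²`.
    refine Summable.of_norm_bounded (hs0.add hs2) fun i => ?_
    rw [Real.norm_eq_abs, abs_mul, abs_of_nonneg (hwt i)]
    nlinarith [hwt i, abs_nonneg (val i), sq_abs (val i), sq_nonneg (|val i| - 1),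
      mul_nonneg (hwt i) (sq_nonneg (|val i| - 1)), mul_nonneg (hwt i) (sq_nonneg (val i))]
  have tot : ∀ k e, Summable (fun i => val i ^ k * wt i) → HasSum (fun M => poi μ M *
      (sampleObs d E.prob μ M ^ k * sampleState E M).trace.re) e →
      ∑' i, val i ^ k * wt i = e := by
    intro k e hk h
    rw [hk.tsum_sigma' fun M => (hasSum_fintype _).summable, ← h.tsum_eq]
    simp only [tsum_fintype, fib]
  have ht0 : ∑' i, wt i = 1 := by
    have h := tot 0 1
    simp only [pow_zero, one_mul] at h
    exact h hs0 h0
  have ht1 : ∑' i, val i * wt i = e₁ := by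
    have h := tot 1 e₁
    simp only [pow_one] at h
    exact h hs1 h1
  have ht2 : ∑' i, val i ^ 2 * wt i = e₂ := tot 2 e₂ hs2 h2
  have hΓ : ∀ i, val i ∈ outcomes E μ := fun i =>
    Set.mem_iUnion.mpr ⟨i.1, eigenvalues_mem_eigenvalueSet (hD i.1) i.2⟩
  classical
  have hout : ∀ X : ℝ, outProb E μ X = ∑' i, if val i = X then wt i else 0 := by
    intro X
    have hsX : Summable fun i => if val i = X then wt i else 0 := by
      exact (hs0.indicator {i | val i = X}).congr fun i => by
        rw [Set.indicator_apply]; rfl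
    rw [hsX.tsum_sigma' fun M => (hasSum_fintype _).summable, outProb]
    refine tsum_congr fun M => ?_
    have : (if X ∈ eigenvalueSet (sampleObs d E.prob μ M) then
        bornProb (sampleObs d E.prob μ M) (sampleState E M) X else 0) =
        bornProb (sampleObs d E.prob μ M) (sampleState E M) X := by
      split_ifs with h
      · rfl
      · exact (bornProb_eq_zero_of_notMem _ _ h).symm
    rw [this, bornProb_eq_sum (hD M), tsum_fintype, Finset.mul_sum]
    exact Finset.sum_congr rfl fun b _ => by rw [mul_ite, mul_zero]
  have mean := hasSum_outcome_mul hΓ (fun x => x) hs1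
  simp only [← hout, ht1] at mean
  have hmean : estMean E μ = e₁ := mean.tsum_eq
  have hsv : HasSum (fun i => (val i - e₁) ^ 2 * wt i) (e₂ - e₁ ^ 2) := by
    convert! (hs2.hasSum.sub (hs1.hasSum.mul_left (2 * e₁))).add (hs0.hasSum.mul_left (e₁ ^ 2))
      using 1
    · funext i; ring
    · rw [ht0, ht1, ht2]; ring
  have var := hasSum_outcome_mul hΓ (fun x => (x - e₁) ^ 2) hsv.summable
  rw [hsv.tsum_eq] at var
  simp only [← hout] at var
  have var' : HasSum (fun X : outcomes E μ => outProb E μ X * ((X : ℝ) - estMean E μ) ^ 2)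
      (e₂ - e₁ ^ 2) := by
    simpa only [hmean, mul_comm] using var
  exact ⟨mean.summable, var'.summable, var'.tsum_eq⟩

end Estimator

end IdentityTest

/-! ### Types, labelings and multinomial weights -/

namespace IdentityTest

variable {N d : ℕ}

/-- The number of registers of each group. -/
def groupCount {N M : ℕ} (g : Fin M → Fin N) (i : Fin N) : ℕ :=
  (Finset.univ.filter fun k => g k = i).card

lemma groupCount_mem_piAntidiag {M : ℕ} (g : Fin M → Fin N) :
    groupCount g ∈ Finset.piAntidiag Finset.univ M := by
  rw [Finset.mem_piAntidiag]
  refine ⟨?_, fun i _ => Finset.mem_univ i⟩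
  have h := Finset.card_eq_sum_card_fiberwise (s := (Finset.univ : Finset (Fin M)))
    (t := Finset.univ) (f := g) (fun _ _ => Finset.mem_univ _)
  rw [Finset.card_univ, Fintype.card_fin] at h
  exact h.symm

lemma prod_comp_eq_prod_pow_groupCount {R : Type*} [CommMonoid R] {M : ℕ} (g : Fin M → Fin N)
    (f : Fin N → R) : ∏ k, f (g k) = ∏ i, f i ^ groupCount g i := by
  rw [← Finset.prod_fiberwise Finset.univ g]
  refine Finset.prod_congr rfl fun i _ => ?_
  rw [groupCount, ← Finset.prod_const]
  exact Finset.prod_congr rfl fun k hk => by rw [(Finset.mem_filter.mp hk).2]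

/-- The multinomial coefficient counts the labelings with given group sizes. -/
lemma card_groupCount_eq_multinomial {M : ℕ} {m : Fin N → ℕ}
    (hm : m ∈ Finset.piAntidiag Finset.univ M) :
    (Finset.univ.filter fun g : Fin M → Fin N => groupCount g = m).card =
      Nat.multinomial Finset.univ m := by
  have mon : ∀ k : Fin N → ℕ, ∏ i, (MvPolynomial.X i : MvPolynomial (Fin N) ℕ) ^ k i =
      MvPolynomial.monomial (Finsupp.equivFunOnFinite.symm k) 1 := by
    intro k
    rw [MvPolynomial.monomial_eq, Finsupp.prod_fintype _ _ (fun i => pow_zero _)]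
    simp
  -- The power of the sum of the variables is expanded both over words and by the multinomial
  -- theorem; the coefficients of the monomial with exponent `m` are then compared.
  have h1 : (∑ i, (MvPolynomial.X i : MvPolynomial (Fin N) ℕ)) ^ M =
      ∑ g : Fin M → Fin N,
        MvPolynomial.monomial (Finsupp.equivFunOnFinite.symm (groupCount g)) 1 := by
    have h := Finset.prod_univ_sum (fun _ : Fin M => (Finset.univ : Finset (Fin N)))
      (fun _ i => (MvPolynomial.X i : MvPolynomial (Fin N) ℕ))
    rw [Finset.prod_const, Finset.card_univ, Fintype.card_fin, Fintype.piFinset_univ] at h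
    rw [h]
    exact Finset.sum_congr rfl fun g _ => by
      rw [prod_comp_eq_prod_pow_groupCount g (fun i => (MvPolynomial.X i)), mon]
  rw [Finset.sum_pow_eq_sum_piAntidiag] at h1
  have h2 := congrArg (MvPolynomial.coeff (Finsupp.equivFunOnFinite.symm m)) h1
  simp only [mon, MvPolynomial.coeff_sum, MvPolynomial.coeff_monomial,
    EmbeddingLike.apply_eq_iff_eq] at h2
  rw [Finset.card_filter, ← h2, Finset.sum_eq_single m]
  · rw [← nsmul_eq_mul, MvPolynomial.coeff_smul, MvPolynomial.coeff_monomial, if_pos rfl,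
      smul_eq_mul, mul_one]
  · intro b _ hb
    rw [← nsmul_eq_mul, MvPolynomial.coeff_smul, MvPolynomial.coeff_monomial,
      if_neg fun h => hb (Finsupp.equivFunOnFinite.symm.injective h), smul_zero]
  · exact fun h => absurd hm h

lemma sum_multinomial_mul {M : ℕ} (F : (Fin N → ℕ) → ℂ) :
    ∑ m : Types N M, (Nat.multinomial Finset.univ m.1 : ℂ) * F m.1 =
      ∑ g : Fin M → Fin N, F (groupCount g) := by
  rw [← Finset.sum_fiberwise_of_maps_to (s := Finset.univ) (t := Finset.piAntidiag Finset.univ M)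
    (g := groupCount) (fun g _ => groupCount_mem_piAntidiag g),
    ← Finset.sum_coe_sort (Finset.piAntidiag Finset.univ M)]
  refine Finset.sum_congr rfl fun m _ => ?_
  rw [← card_groupCount_eq_multinomial m.2, Finset.sum_congr rfl (g := fun _ => F m.1)
    (fun g hg => by rw [(Finset.mem_filter.mp hg).2]), Finset.sum_const, nsmul_eq_mul]

/-! ### Labeled registers and their reindexing -/

section Labeled

variable {S S' : Type*} [Fintype S] [DecidableEq S] [Fintype S'] [DecidableEq S']

/-- The trace of the permutation `τ` of the registers in the product of the states labeled by
`g`. -/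
noncomputable def permTrace (E : Ensemble N d) (g : S → Fin N) (τ : Equiv.Perm S) : ℂ :=
  ∑ y : S → Fin d, ∏ s, E.state (g s) (y s) (y (τ s))

/-- `δ_{ij} / p_i - 1`. -/
noncomputable def pairCoeff (p : Fin N → ℝ) (i j : Fin N) : ℝ := (if i = j then (p i)⁻¹ else 0) - 1

lemma pairCoeff_comm (p : Fin N → ℝ) (i j : Fin N) : pairCoeff p i j = pairCoeff p j i := by
  unfold pairCoeff
  by_cases h : i = j
  · rw [h]
  · rw [if_neg h, if_neg (Ne.symm h)]

/-- The coefficient of the swap of the registers `s` and `t` in the observable. -/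
noncomputable def siteCoeff (p : Fin N → ℝ) (g : S → Fin N) (s t : S) : ℝ :=
  if s = t then 0 else pairCoeff p (g s) (g t)

/-- Renaming registers conjugates the permutation. This lets moments on the registers `Site m` be
computed on `Fin M`. -/
lemma permTrace_comp_equiv (E : Ensemble N d) (g : S' → Fin N) (e : S ≃ S')
    (τ : Equiv.Perm S) : permTrace E (g ∘ e) τ = permTrace E g (e.permCongr τ) := by
  unfold permTrace
  rw [← (e.arrowCongr (Equiv.refl (Fin d))).symm.sum_comp]
  refine Finset.sum_congr rfl fun y _ => ?_
  rw [← e.prod_comp]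
  simp [Equiv.permCongr_apply]

omit [Fintype S] [Fintype S'] in
lemma siteCoeff_comp_equiv (p : Fin N → ℝ) (g : S' → Fin N) (e : S ≃ S') (s t : S) :
    siteCoeff p (g ∘ e) s t = siteCoeff p g (e s) (e t) := by
  simp [siteCoeff]

/-- The first moment of the observable for the labeling `g`, up to normalization. -/
noncomputable def labelMean (E : Ensemble N d) (g : S → Fin N) : ℂ :=
  ∑ s, ∑ t, (siteCoeff E.prob g s t : ℂ) * permTrace E g (Equiv.swap s t)

/-- The second moment of the observable for the labeling `g`, up to normalization. -/
noncomputable def labelSecond (E : Ensemble N d) (g : S → Fin N) : ℂ :=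
  ∑ s, ∑ t, ∑ u, ∑ v, (siteCoeff E.prob g s t : ℂ) * siteCoeff E.prob g u v *
    permTrace E g (Equiv.swap u v * Equiv.swap s t)

omit [Fintype S] [Fintype S'] in
lemma permCongr_swap (e : S ≃ S') (s t : S) :
    e.permCongr (Equiv.swap s t) = Equiv.swap (e s) (e t) := by
  rw [Equiv.permCongr_def, Equiv.symm_trans_swap_trans]

lemma labelMean_comp_equiv (E : Ensemble N d) (g : S' → Fin N) (e : S ≃ S') :
    labelMean E (g ∘ e) = labelMean E g := by
  unfold labelMean
  simp_rw [siteCoeff_comp_equiv, permTrace_comp_equiv, permCongr_swap]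
  rw [← e.sum_comp]
  exact Finset.sum_congr rfl fun s _ => e.sum_comp
    (fun t => (siteCoeff E.prob g (e s) t : ℂ) * permTrace E g (Equiv.swap (e s) t))

lemma labelSecond_comp_equiv (E : Ensemble N d) (g : S' → Fin N) (e : S ≃ S') :
    labelSecond E (g ∘ e) = labelSecond E g := by
  unfold labelSecond
  simp_rw [siteCoeff_comp_equiv, permTrace_comp_equiv, Equiv.permCongr_mul, permCongr_swap]
  rw [← e.sum_comp]
  refine Finset.sum_congr rfl fun s _ => ?_
  rw [← e.sum_comp]
  refine Finset.sum_congr rfl fun t _ => ?_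
  rw [← e.sum_comp]
  exact Finset.sum_congr rfl fun u _ => e.sum_comp
    (fun v => (siteCoeff E.prob g (e s) (e t) : ℂ) * siteCoeff E.prob g (e u) v *
      permTrace E g (Equiv.swap (e u) v * Equiv.swap (e s) (e t)))

/-- The registers of a labeling, sorted by their group. -/
noncomputable def siteEquiv {M : ℕ} (g : Fin M → Fin N) :
    {e : Site (groupCount g) ≃ Fin M // ∀ s, g (e s) = s.1} :=
  ⟨(Equiv.sigmaCongrRight fun i => (Fintype.equivFinOfCardEq
      (α := {k : Fin M // g k = i}) (Fintype.card_subtype _)).symm).trans (Equiv.sigmaFiberEquiv g),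
    fun s => ((Fintype.equivFinOfCardEq (α := {k : Fin M // g k = s.1})
      (Fintype.card_subtype _)).symm s.2).2⟩

end Labeled

/-! ### Permutation operators on the product space -/

section Operators

variable {m : Fin N → ℕ}

lemma permOp_mul_apply (τ : Equiv.Perm (Site m)) (A : Matrix (Config d m) (Config d m) ℂ)
    (x y : Config d m) : (permOp d τ * A) x y = A (x ∘ τ.symm) y := by
  rw [Matrix.mul_apply, Finset.sum_eq_single (x ∘ τ.symm)]
  · simp [permOp, Function.comp_assoc]
  · intro z _ hz
    rw [permOp, Matrix.of_apply, if_neg, zero_mul]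
    rintro rfl
    exact hz (by simp [Function.comp_assoc])
  · simp

/-- Permutations act by precomposition, which reverses the order of products; hence the order of the
two swaps in `labelSecond`. -/
lemma permOp_mul_permOp (τ τ' : Equiv.Perm (Site m)) :
    permOp d τ * permOp d τ' = permOp d (τ' * τ) := by
  ext x y
  rw [permOp_mul_apply, permOp, permOp, Matrix.of_apply, Matrix.of_apply]
  refine if_congr ⟨fun h => ?_, fun h => ?_⟩ rfl rfl
  · funext s
    have := congrFun h (τ s)
    simpa using this
  · subst h
    funext s
    simp

lemma trace_permOp_mul_productState (E : Ensemble N d) (τ : Equiv.Perm (Site m)) :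
    (permOp d τ * productState E m).trace = permTrace E (fun s : Site m => s.1) τ := by
  rw [Matrix.trace, permTrace, ← (τ.arrowCongr (Equiv.refl (Fin d))).symm.sum_comp]
  refine Finset.sum_congr rfl fun y _ => ?_
  rw [Matrix.diag_apply, permOp_mul_apply, productState, Matrix.of_apply]
  refine Finset.prod_congr rfl fun s _ => ?_
  simp

lemma permOp_swap_isHermitian (s t : Site m) : (permOp d (Equiv.swap s t)).IsHermitian := by
  ext x y
  rw [Matrix.conjTranspose_apply, permOp, Matrix.of_apply, Matrix.of_apply, apply_ite star,
    star_one, star_zero]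
  refine if_congr ⟨?_, ?_⟩ rfl rfl <;>
  · rintro rfl
    funext s
    simp

end Operators

end IdentityTest

/-! ### The observable as a weighted sum of swaps -/

namespace IdentityTest

variable {N d : ℕ}

section Operators

variable {m : Fin N → ℕ}

/-- The sum of the swaps over ordered pairs of distinct registers of the groups `i` and `j`. -/
noncomputable def groupSwapSum (d : ℕ) (m : Fin N → ℕ) (i j : Fin N) :
    Matrix (Config d m) (Config d m) ℂ :=
  ∑ a : Fin (m i), ∑ b : Fin (m j),
    if (⟨i, a⟩ : Site m) = ⟨j, b⟩ then 0 else permOp d (Equiv.swap (⟨i, a⟩ : Site m) ⟨j, b⟩)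

/-- The pairs of distinct registers of the groups `i` and `j`. -/
def distinctPairs (m : Fin N → ℕ) (i j : Fin N) : Finset (Fin (m i) × Fin (m j)) :=
  Finset.univ.filter fun q => (⟨i, q.1⟩ : Site m) ≠ ⟨j, q.2⟩

lemma transpositions_eq_image (i j : Fin N) :
    transpositions m i j = (distinctPairs m i j).image
      fun q => Equiv.swap (⟨i, q.1⟩ : Site m) ⟨j, q.2⟩ := by
  ext τ
  simp only [transpositions, distinctPairs, Finset.mem_filter, Finset.mem_univ, true_and,
    Finset.mem_image, Prod.exists]
  exact exists₂_congr fun a b => and_congr_right fun _ => eq_comm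

lemma groupSwapSum_eq (i j : Fin N) : groupSwapSum d m i j =
    ∑ q ∈ distinctPairs m i j, permOp d (Equiv.swap (⟨i, q.1⟩ : Site m) ⟨j, q.2⟩) := by
  rw [groupSwapSum, distinctPairs, Finset.sum_filter, Fintype.sum_prod_type]
  simp only [ne_eq, ite_not]

/-- If every transposition comes from the same number `k` of pairs, averaging over transpositions or
over pairs is the same, so the multiplicity cancels. -/
lemma card_smul_avgSwap_of_fiber {i j : Fin N} {k : ℕ}
    (hk : ∀ q ∈ distinctPairs m i j, ((distinctPairs m i j).filter fun q' =>
      Equiv.swap (⟨i, q'.1⟩ : Site m) ⟨j, q'.2⟩ = Equiv.swap ⟨i, q.1⟩ ⟨j, q.2⟩).card = k) :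
    ((distinctPairs m i j).card : ℂ) • avgSwap d m i j = groupSwapSum d m i j := by
  have h1 : groupSwapSum d m i j = k • ∑ τ ∈ transpositions m i j, permOp d τ := by
    rw [groupSwapSum_eq, transpositions_eq_image, Finset.sum_comp (f := permOp d)
      (g := fun q : Fin (m i) × Fin (m j) => Equiv.swap (⟨i, q.1⟩ : Site m) ⟨j, q.2⟩),
      Finset.smul_sum]
    refine Finset.sum_congr rfl fun τ hτ => ?_
    obtain ⟨q, hq, rfl⟩ := Finset.mem_image.mp hτ
    rw [hk q hq]
  have h2 : (distinctPairs m i j).card = k * (transpositions m i j).card := by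
    rw [transpositions_eq_image, Finset.card_eq_sum_card_image
      (fun q : Fin (m i) × Fin (m j) => Equiv.swap (⟨i, q.1⟩ : Site m) ⟨j, q.2⟩), mul_comm,
      ← smul_eq_mul, ← Finset.sum_const]
    refine Finset.sum_congr rfl fun τ hτ => ?_
    obtain ⟨q, hq, rfl⟩ := Finset.mem_image.mp hτ
    rw [hk q hq]
  rw [h1, h2, avgSwap, smul_smul]
  -- Without transpositions the inverse of the cardinality is `0⁻¹`, but both sides are zero.
  rcases (transpositions m i j).eq_empty_or_nonempty with h | h
  · simp [h]
  · have : ((transpositions m i j).card : ℂ) ≠ 0 := by exact_mod_cast h.card_pos.ne'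
    rw [Nat.cast_mul, mul_assoc, mul_inv_cancel₀ this, mul_one, Nat.cast_smul_eq_nsmul]

lemma site_mk_ne_iff {i : Fin N} {a b : Fin (m i)} : (⟨i, a⟩ : Site m) ≠ ⟨i, b⟩ ↔ a ≠ b := by
  simp

lemma swap_eq_swap_iff {α : Type*} [DecidableEq α] {a b c e : α} (h : a ≠ b) :
    Equiv.swap c e = Equiv.swap a b ↔ c = a ∧ e = b ∨ c = b ∧ e = a := by
  constructor
  · intro hs
    have h1 := congrArg (fun τ => τ a) hs
    have h2 := congrArg (fun τ => τ b) hs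
    simp only [Equiv.swap_apply_left, Equiv.swap_apply_right] at h1 h2
    rw [Equiv.swap_apply_def] at h1 h2
    grind
  · rintro (⟨rfl, rfl⟩ | ⟨rfl, rfl⟩)
    · rfl
    · exact Equiv.swap_comm _ _

/-- Within one group, `(a, b)` and `(b, a)` give the same transposition, so the fibers have two
elements. -/
lemma groupSwapSum_self (i : Fin N) :
    (m i * (m i - 1) : ℝ) • avgSwap d m i i = groupSwapSum d m i i := by
  rw [← card_smul_avgSwap_of_fiber (k := 2)]
  · have hc : (distinctPairs m i i).card = m i * m i - m i := by
      have h : distinctPairs m i i = Finset.univ.offDiag := by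
        ext q
        simp [distinctPairs, Finset.mem_offDiag]
      rw [h, Finset.offDiag_card, Finset.card_univ, Fintype.card_fin]
    rw [hc, Nat.cast_sub (Nat.le_mul_self _), ← Complex.coe_smul]
    push_cast
    ring_nf
  · intro q hq
    have hne : (⟨i, q.1⟩ : Site m) ≠ ⟨i, q.2⟩ := (Finset.mem_filter.mp hq).2
    have hne' : q.1 ≠ q.2 := site_mk_ne_iff.mp hne
    have : (distinctPairs m i i).filter (fun q' =>
        Equiv.swap (⟨i, q'.1⟩ : Site m) ⟨i, q'.2⟩ = Equiv.swap ⟨i, q.1⟩ ⟨i, q.2⟩) =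
        {q, q.swap} := by
      ext ⟨a, b⟩
      obtain ⟨u, v⟩ := q
      simp only [distinctPairs, Finset.mem_filter, Finset.mem_univ, true_and, Prod.swap,
        Finset.mem_insert, Finset.mem_singleton, Prod.mk.injEq, swap_eq_swap_iff hne,
        Sigma.mk.injEq, heq_eq_eq, ne_eq] at hne' ⊢
      grind
    rw [this, Finset.card_pair]
    intro h
    exact hne' (congrArg Prod.fst h)

lemma groupSwapSum_of_ne {i j : Fin N} (hij : i ≠ j) :
    (m i * m j : ℝ) • avgSwap d m i j = groupSwapSum d m i j := by
  have hne : ∀ a b, (⟨i, a⟩ : Site m) ≠ ⟨j, b⟩ := fun a b h => hij (congrArg Sigma.fst h)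
  rw [← card_smul_avgSwap_of_fiber (k := 1)]
  · have hc : (distinctPairs m i j).card = m i * m j := by
      rw [distinctPairs, Finset.filter_true_of_mem fun q _ => hne _ _]
      simp
    rw [hc, ← Complex.coe_smul]
    push_cast
    rfl
  · intro q hq
    rw [Finset.card_eq_one]
    refine ⟨q, ?_⟩
    ext ⟨a, b⟩
    obtain ⟨u, v⟩ := q
    simp only [distinctPairs, Finset.mem_filter, Finset.mem_univ, true_and,
      Finset.mem_singleton, Prod.mk.injEq, swap_eq_swap_iff (hne u v), hne, ne_eq,
      not_false_eq_true]
    constructor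
    · rintro (h | h)
      · simpa using h
      · exact h.1.elim
    · rintro ⟨rfl, rfl⟩
      simp

/-- The `O_{ii}` terms add up over `j ≠ i` to the coefficient `(1 - p_i) / p_i = 1 / p_i - 1`, and
the `O_{jj}` terms double it by symmetry. The cross terms carry `-2`, so a common factor `2` comes
out. -/
lemma typeObs_eq {p : Fin N → ℝ} (hp : ∀ i, 0 < p i) (hsum : ∑ i, p i = 1) {μ : ℝ} (hμ : 0 < μ) :
    typeObs d p μ m = (2 / μ ^ 2 : ℝ) • ∑ s : Site m, ∑ t : Site m,
      siteCoeff p (fun s : Site m => s.1) s t • permOp d (Equiv.swap s t) := by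
  have hpair : ∀ i j, i ≠ j → pairObs d p μ m i j =
      (1 / (μ ^ 2 * p i) * p j) • groupSwapSum d m i i
        + (1 / (μ ^ 2 * p j) * p i) • groupSwapSum d m j j
        - (2 / μ ^ 2) • groupSwapSum d m i j := by
    intro i j hij
    rw [pairObs, ← groupSwapSum_self, ← groupSwapSum_self, ← groupSwapSum_of_ne hij, smul_smul,
      smul_smul, smul_smul]
    congr 2 <;> ring_nf
  have hrhs : ∑ s : Site m, ∑ t : Site m,
      siteCoeff p (fun s : Site m => s.1) s t • permOp d (Equiv.swap s t) =
      ∑ i, ∑ j, pairCoeff p i j • groupSwapSum d m i j := by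
    simp only [Fintype.sum_sigma]
    refine Finset.sum_congr rfl fun i _ => ?_
    rw [Finset.sum_comm]
    refine Finset.sum_congr rfl fun j _ => ?_
    rw [groupSwapSum, Finset.smul_sum]
    refine Finset.sum_congr rfl fun a _ => ?_
    rw [Finset.smul_sum]
    refine Finset.sum_congr rfl fun b _ => ?_
    rw [siteCoeff]
    split_ifs <;> simp
  have hside : ∀ i, ∑ j ∈ Finset.univ.filter (fun j => i ≠ j),
      (1 / (μ ^ 2 * p i) * p j) • groupSwapSum d m i i =
      ((1 / μ ^ 2) * pairCoeff p i i) • groupSwapSum d m i i := by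
    intro i
    rw [← Finset.sum_smul, ← Finset.mul_sum]
    congr 1
    have : ∑ j ∈ Finset.univ.filter (fun j => i ≠ j), p j = 1 - p i := by
      rw [← hsum, ← Finset.sum_erase_eq_sub (Finset.mem_univ i)]
      refine Finset.sum_congr ?_ fun _ _ => rfl
      ext j
      simp [eq_comm]
    rw [this, pairCoeff, if_pos rfl]
    have := (hp i).ne'
    field_simp
  have hoff : ∀ i j, i ≠ j → pairCoeff p i j = -1 := fun i j hij => by
    rw [pairCoeff, if_neg hij]; ring
  rw [hrhs, typeObs, Finset.sum_congr rfl fun i _ => Finset.sum_congr rfl fun j hj =>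
    hpair i j (Finset.mem_filter.mp hj).2]
  simp only [Finset.sum_sub_distrib, Finset.sum_add_distrib]
  have hswap : ∑ i, ∑ j ∈ Finset.univ.filter (fun j => i ≠ j),
      (1 / (μ ^ 2 * p j) * p i) • groupSwapSum d m j j = ∑ i, ∑ j ∈ Finset.univ.filter
        (fun j => i ≠ j), (1 / (μ ^ 2 * p i) * p j) • groupSwapSum d m i i := by
    simp only [Finset.sum_filter]
    rw [Finset.sum_comm]
    refine Finset.sum_congr rfl fun i _ => Finset.sum_congr rfl fun j _ => ?_
    simp only [ne_comm]
  rw [hswap, Finset.sum_congr rfl fun i _ => hside i, Finset.smul_sum, ← Finset.sum_add_distrib,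
    ← Finset.sum_sub_distrib]
  refine Finset.sum_congr rfl fun i _ => ?_
  rw [← Finset.add_sum_erase _ _ (Finset.mem_univ i), smul_add, smul_smul, Finset.smul_sum,
    ← add_smul, sub_eq_add_neg, ← Finset.sum_neg_distrib]
  congr 1
  · congr 1; ring
  · refine Finset.sum_congr (by ext j; simp [eq_comm]) fun j hj => ?_
    rw [hoff i j (Finset.ne_of_mem_erase hj).symm, neg_one_smul, smul_neg]

lemma typeObs_isHermitian (E : Ensemble N d) {μ : ℝ} (hμ : 0 < μ) :
    (typeObs d E.prob μ m).IsHermitian := by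
  rw [typeObs_eq E.prob_pos E.prob_sum hμ, Matrix.IsHermitian]
  simp only [Matrix.conjTranspose_smul, Matrix.conjTranspose_sum, star_trivial,
    (permOp_swap_isHermitian _ _).eq]

lemma sampleObs_isHermitian (E : Ensemble N d) {μ : ℝ} (hμ : 0 < μ) (M : ℕ) :
    (sampleObs d E.prob μ M).IsHermitian :=
  Matrix.isHermitian_blockDiagonal'_iff.mpr fun _ => typeObs_isHermitian E hμ

open scoped MatrixOrder Matrix.Norms.L2Operator in
lemma exists_conjTranspose_mul_self {n : Type*} [Fintype n] [DecidableEq n] {A : Matrix n n ℂ}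
    (hA : A.PosSemidef) : ∃ B : Matrix n n ℂ, A = Bᴴ * B :=
  CStarAlgebra.nonneg_iff_eq_star_mul_self.mp hA.nonneg

/-- With `ρ_i = B_iᴴ B_i`, the product state is `Pᴴ P` for `P` the tensor product of the `B_i`. -/
lemma productState_posSemidef (E : Ensemble N d) : (productState E m).PosSemidef := by
  choose B hB using fun i => exists_conjTranspose_mul_self
    (E.state_posSemidef i)
  let P : Matrix (Config d m) (Config d m) ℂ :=
    Matrix.of fun z x => ∏ s : Site m, B s.1 (z s) (x s)
  have h : productState E m = Pᴴ * P := by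
    ext x y
    rw [productState, Matrix.of_apply, Matrix.mul_apply]
    simp only [hB, Matrix.mul_apply, P, Matrix.conjTranspose_apply, Matrix.of_apply, star_prod,
      ← Finset.prod_mul_distrib]
    rw [Finset.prod_univ_sum, Fintype.piFinset_univ]
  rw [h]
  exact Matrix.posSemidef_conjTranspose_mul_self P

lemma sampleState_posSemidef (E : Ensemble N d) (M : ℕ) : (sampleState E M).PosSemidef := by
  have hc : ∀ m : Types N M,
      (0 : ℝ) ≤ Nat.multinomial Finset.univ m.1 * ∏ i, E.prob i ^ m.1 i := fun m =>
    mul_nonneg (Nat.cast_nonneg _) (Finset.prod_nonneg fun i _ => pow_nonneg (E.prob_pos i).le _)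
  choose B hB using fun m : Types N M => exists_conjTranspose_mul_self
    ((productState_posSemidef (m := m.1) E).smul (hc m))
  have h : sampleState E M = (Matrix.blockDiagonal' B)ᴴ * Matrix.blockDiagonal' B := by
    rw [Matrix.blockDiagonal'_conjTranspose, ← Matrix.blockDiagonal'_mul, sampleState]
    congr 1
    funext m
    exact hB m
  rw [h]
  exact Matrix.posSemidef_conjTranspose_mul_self _

/-- The mean of the observable for a given type. -/
lemma trace_typeObs_mul (E : Ensemble N d) {μ : ℝ} (hμ : 0 < μ) :
    (typeObs d E.prob μ m * productState E m).trace =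
      (2 / μ ^ 2 : ℝ) * labelMean E (fun s : Site m => s.1) := by
  rw [typeObs_eq E.prob_pos E.prob_sum hμ, labelMean]
  simp only [Matrix.smul_mul, Matrix.sum_mul, Matrix.trace_smul, Matrix.trace_sum,
    trace_permOp_mul_productState, Complex.real_smul]

/-- The second moment of the observable for a given type. -/
lemma trace_typeObs_sq_mul (E : Ensemble N d) {μ : ℝ} (hμ : 0 < μ) :
    (typeObs d E.prob μ m ^ 2 * productState E m).trace =
      (2 / μ ^ 2 : ℝ) ^ 2 * labelSecond E (fun s : Site m => s.1) := by
  rw [typeObs_eq E.prob_pos E.prob_sum hμ, labelSecond, sq]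
  simp only [Matrix.smul_mul, Matrix.mul_smul, Matrix.sum_mul]
  simp only [Matrix.smul_mul, Matrix.mul_smul, Matrix.sum_mul, Matrix.mul_sum]
  simp only [Matrix.trace_smul, Matrix.trace_sum, permOp_mul_permOp,
    trace_permOp_mul_productState, Complex.real_smul, Finset.mul_sum]
  refine Finset.sum_congr rfl fun s _ => Finset.sum_congr rfl fun t _ =>
    Finset.sum_congr rfl fun u _ => Finset.sum_congr rfl fun v _ => ?_
  ring

end Operators

lemma trace_sampleObs_pow_mul (E : Ensemble N d) (μ : ℝ) (M k : ℕ) :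
    (sampleObs d E.prob μ M ^ k * sampleState E M).trace =
      ∑ m : Types N M, (Nat.multinomial Finset.univ m.1 : ℂ) *
        ((∏ i, (E.prob i : ℂ) ^ m.1 i) *
          (typeObs d E.prob μ m.1 ^ k * productState E m.1).trace) := by
  have h : sampleObs d E.prob μ M ^ k =
      Matrix.blockDiagonal' fun m : Types N M => typeObs d E.prob μ m.1 ^ k := by
    rw [sampleObs, ← Matrix.blockDiagonal'_pow]
    rfl
  rw [h, sampleState, ← Matrix.blockDiagonal'_mul, Matrix.trace_blockDiagonal']
  refine Finset.sum_congr rfl fun m _ => ?_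
  rw [Matrix.mul_smul, Matrix.trace_smul, Complex.real_smul, ← mul_assoc]
  push_cast
  rfl

/-- The expectation over `M` independent labels. -/
lemma trace_sampleObs_pow_mul_eq_sum_labels (E : Ensemble N d) {μ : ℝ} {M k : ℕ} {c : ℂ}
    (L : ∀ {S : Type} [Fintype S] [DecidableEq S], (S → Fin N) → ℂ)
    (hL : ∀ {m : Fin N → ℕ} (g : Fin M → Fin N) (e : Site m ≃ Fin M), L (g ∘ e) = L g)
    (hk : ∀ m : Fin N → ℕ, (typeObs d E.prob μ m ^ k * productState E m).trace =
      c * L (fun s : Site m => s.1)) :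
    (sampleObs d E.prob μ M ^ k * sampleState E M).trace =
      c * ∑ g : Fin M → Fin N, (∏ s, (E.prob (g s) : ℂ)) * L g := by
  rw [trace_sampleObs_pow_mul, sum_multinomial_mul (F := fun m => (∏ i, (E.prob i : ℂ) ^ m i) *
          (typeObs d E.prob μ m ^ k * productState E m).trace), Finset.mul_sum]
  refine Finset.sum_congr rfl fun g _ => ?_
  -- Sorting the registers of `g` by label identifies the canonical labeling of `Site (groupCount
  -- g)` with `g`.
  have h := hL g (siteEquiv g).1
  rw [funext (siteEquiv g).2 (f := g ∘ (siteEquiv g).1)] at h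
  rw [hk, h, ← prod_comp_eq_prod_pow_groupCount g (fun i => (E.prob i : ℂ))]
  ring

end IdentityTest

/-! ### Expectations over independent labels -/

namespace IdentityTest

variable {N d : ℕ}

/-- Summing out coordinates whose weights add up to one. -/
lemma sum_comp_mul_prod_of_injective {K ι α : Type*} [Fintype K] [DecidableEq K] [Fintype ι]
    [DecidableEq ι] [Fintype α] {w : α → ℂ} (hw : ∑ a, w a = 1) {e : ι → K}
    (he : Function.Injective e) (F : (ι → α) → ℂ) :
    ∑ z : K → α, F (z ∘ e) * ∏ s : {s // s ∉ Set.range e}, w (z s) = ∑ z : ι → α, F z := by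
  classical
  let e' : ι ⊕ {s // s ∉ Set.range e} ≃ K :=
    (Equiv.sumCongr (Equiv.ofInjective e he) (Equiv.refl _)).trans
      (Equiv.sumCompl (· ∈ Set.range e))
  rw [← (e'.arrowCongr (Equiv.refl α)).sum_comp,
    ← (Equiv.sumArrowEquivProdArrow ι {s // s ∉ Set.range e} α).symm.sum_comp,
    Fintype.sum_prod_type]
  refine Finset.sum_congr rfl fun z _ => ?_
  have h1 : ∀ z', ((e'.arrowCongr (Equiv.refl α))
      ((Equiv.sumArrowEquivProdArrow ι {s // s ∉ Set.range e} α).symm (z, z'))) ∘ e = z := by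
    intro z'
    funext i
    have : e'.symm (e i) = Sum.inl i := by
      rw [Equiv.symm_apply_eq]; rfl
    simp [Equiv.arrowCongr_apply, this]
  have h2 : ∀ z' (s : {s // s ∉ Set.range e}), ((e'.arrowCongr (Equiv.refl α))
      ((Equiv.sumArrowEquivProdArrow ι {s // s ∉ Set.range e} α).symm (z, z'))) s = z' s := by
    intro z' s
    have : e'.symm s = Sum.inr s := by
      rw [Equiv.symm_apply_eq]; rfl
    simp [Equiv.arrowCongr_apply, this]
  simp only [h1, h2]
  rw [← Finset.mul_sum, ← Fintype.piFinset_univ,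
    ← Finset.prod_univ_sum (fun _ => Finset.univ) (fun _ a => w a)]
  simp [hw]

/-- An entry of `∑ i, p_i |i⟩⟨i| ⊗ ρ_i`. -/
noncomputable def jointEntry (E : Ensemble N d) (z w : Fin N × Fin d) : ℂ :=
  E.prob z.1 * E.state z.1 z.2 w.2

lemma sum_jointEntry_self (E : Ensemble N d) : ∑ z, jointEntry E z z = 1 := by
  rw [Fintype.sum_prod_type]
  have h : ∀ i, ∑ a, jointEntry E (i, a) (i, a) = E.prob i := fun i => by
    have := E.state_trace i
    rw [Matrix.trace] at this
    simp only [jointEntry, ← Finset.mul_sum]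
    simp only [Matrix.diag_apply] at this
    rw [this, mul_one]
  simp only [h, ← Complex.ofReal_sum, E.prob_sum, Complex.ofReal_one]

section Expectation

variable {K ι : Type*} [Fintype K] [DecidableEq K] [Fintype ι] [DecidableEq ι]

/-- The expectation of `C g` times the permutation `τ` over independent labels `g`. -/
noncomputable def permExp (E : Ensemble N d) (C : (K → Fin N) → ℂ) (τ : Equiv.Perm K) : ℂ :=
  ∑ z : K → Fin N × Fin d, C (fun s => (z s).1) * ∏ s, jointEntry E (z s) (z (τ s))

/-- Label and basis index of a register merge into one index, and the label's probability is
absorbed into `jointEntry`. -/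
lemma sum_labels_eq_permExp (E : Ensemble N d) (C : (K → Fin N) → ℂ) (τ : Equiv.Perm K) :
    ∑ g : K → Fin N, (∏ s, (E.prob (g s) : ℂ)) * (C g * permTrace E g τ) = permExp E C τ := by
  rw [permExp, ← (Equiv.arrowProdEquivProdArrow K (fun _ => Fin N) (fun _ => Fin d)).symm.sum_comp,
    Fintype.sum_prod_type]
  refine Finset.sum_congr rfl fun g _ => ?_
  rw [permTrace, Finset.mul_sum, Finset.mul_sum]
  refine Finset.sum_congr rfl fun y _ => ?_
  simp only [Equiv.arrowProdEquivProdArrow, Equiv.coe_fn_symm_mk, jointEntry,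
    Finset.prod_mul_distrib]
  ring

/-- Registers outside the range of `e` are fixed by `τ` and ignored by the coefficient; each
contributes the trace of the joint state, which is one. -/
lemma permExp_comp_of_injective (E : Ensemble N d) (C : (ι → Fin N) → ℂ) {e : ι → K}
    (he : Function.Injective e) {τ : Equiv.Perm K} {σ : Equiv.Perm ι} (hσ : ∀ i, τ (e i) = e (σ i))
    (hτ : ∀ s, s ∉ Set.range e → τ s = s) :
    permExp E (fun g => C (g ∘ e)) τ = permExp E C σ := by
  classical
  rw [permExp, permExp, ← sum_comp_mul_prod_of_injective (sum_jointEntry_self E) he]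
  refine Finset.sum_congr rfl fun z _ => ?_
  rw [mul_assoc]
  congr 1
  rw [← Fintype.prod_subtype_mul_prod_subtype (· ∈ Set.range e)]
  congr 1
  · convert! (Fintype.prod_equiv (Equiv.ofInjective e he)
      (fun i => jointEntry E (z (e i)) (z (e (σ i))))
      (fun s => jointEntry E (z s) (z (τ s))) (fun i => by simp [hσ])).symm
  · exact Finset.prod_congr rfl fun s _ => by rw [hτ s s.2]

end Expectation

lemma sum_fin_succ_fun {α : Type*} [Fintype α] {n : ℕ} (f : (Fin (n + 1) → α) → ℂ) :
    ∑ z, f z = ∑ a, ∑ z : Fin n → α, f (Fin.cons a z) := by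
  rw [← (Fin.consEquiv fun _ => α).sum_comp, Fintype.sum_prod_type]
  rfl

lemma sum_fin_two_fun {α : Type*} [Fintype α] (f : (Fin 2 → α) → ℂ) :
    ∑ z, f z = ∑ a, ∑ b, f ![a, b] := by
  simp only [sum_fin_succ_fun, Fintype.sum_unique]
  rfl

lemma sum_fin_three_fun {α : Type*} [Fintype α] (f : (Fin 3 → α) → ℂ) :
    ∑ z, f z = ∑ a, ∑ b, ∑ c, f ![a, b, c] := by
  simp only [sum_fin_succ_fun, Fintype.sum_unique]
  rfl

lemma sum_fin_four_fun {α : Type*} [Fintype α] (f : (Fin 4 → α) → ℂ) :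
    ∑ z, f z = ∑ a, ∑ b, ∑ c, ∑ e, f ![a, b, c, e] := by
  simp only [sum_fin_succ_fun, Fintype.sum_unique]
  rfl

/-- The expectation of a weighted swap of two registers. -/
noncomputable def swapMean (E : Ensemble N d) : ℂ :=
  ∑ a, ∑ b, (pairCoeff E.prob a.1 b.1 : ℂ) * (jointEntry E a b * jointEntry E b a)

/-- The expectation of a product of two weighted swaps with one common register. -/
noncomputable def cycleMean (E : Ensemble N d) : ℂ :=
  ∑ a, ∑ b, ∑ c, (pairCoeff E.prob a.1 b.1 : ℂ) * pairCoeff E.prob b.1 c.1 *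
    (jointEntry E a c * jointEntry E b a * jointEntry E c b)

/-- The expectation of the square of a weighted swap. -/
noncomputable def squareMean (E : Ensemble N d) : ℂ :=
  ∑ a, ∑ b, (pairCoeff E.prob a.1 b.1 : ℂ) ^ 2 * (jointEntry E a a * jointEntry E b b)

/-! ### Overlap patterns of two swaps -/

section Patterns

variable {K : Type*} [Fintype K] [DecidableEq K]

/-- The expectation of a product of two weighted swaps. -/
noncomputable def swapPairMean (E : Ensemble N d) (s t u v : K) : ℂ :=
  permExp E (fun g => (siteCoeff E.prob g s t : ℂ) * siteCoeff E.prob g u v)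
    (Equiv.swap u v * Equiv.swap s t)

omit [Fintype K] in
lemma siteCoeff_comm (p : Fin N → ℝ) (g : K → Fin N) (s t : K) :
    siteCoeff p g s t = siteCoeff p g t s := by
  unfold siteCoeff
  rw [pairCoeff_comm]
  exact if_congr eq_comm rfl rfl

lemma swapPairMean_comm_left (E : Ensemble N d) (s t u v : K) :
    swapPairMean E s t u v = swapPairMean E t s u v := by
  unfold swapPairMean
  simp only [siteCoeff_comm E.prob _ s t, Equiv.swap_comm s t]

lemma swapPairMean_comm_right (E : Ensemble N d) (s t u v : K) :
    swapPairMean E s t u v = swapPairMean E s t v u := by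
  unfold swapPairMean
  simp only [siteCoeff_comm E.prob _ u v, Equiv.swap_comm u v]

lemma swapPairMean_self_right (E : Ensemble N d) (s t u : K) : swapPairMean E s t u u = 0 := by
  simp [swapPairMean, siteCoeff, permExp]

lemma swapPairMean_self_left (E : Ensemble N d) (s u v : K) : swapPairMean E s s u v = 0 := by
  simp [swapPairMean, siteCoeff, permExp]

lemma permExp_swap (E : Ensemble N d) {s t : K} (h : s ≠ t) :
    permExp E (fun g => (siteCoeff E.prob g s t : ℂ)) (Equiv.swap s t) = swapMean E := by
  have he : Function.Injective ![s, t] := by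
    intro i j; fin_cases i <;> fin_cases j <;> simp [h, h.symm]
  have h1 := permExp_comp_of_injective E (fun g => (pairCoeff E.prob (g 0) (g 1) : ℂ)) he
    (τ := Equiv.swap s t) (σ := Equiv.swap 0 1) (by
      intro i; fin_cases i <;> simp) (by
      intro r hr
      have hs : r ≠ s := fun h' => hr ⟨0, h'.symm⟩
      have ht : r ≠ t := fun h' => hr ⟨1, h'.symm⟩
      exact Equiv.swap_apply_of_ne_of_ne hs ht)
  simp only [siteCoeff, if_neg h]
  refine Eq.trans h1 ?_
  rw [permExp, sum_fin_two_fun]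
  simp [swapMean, Fin.prod_univ_two]

lemma swapPairMean_of_eq_eq (E : Ensemble N d) {s t : K} (h : s ≠ t) :
    swapPairMean E s t s t = squareMean E := by
  have he : Function.Injective ![s, t] := by
    intro i j; fin_cases i <;> fin_cases j <;> simp [h, h.symm]
  have h1 := permExp_comp_of_injective E (fun g => (pairCoeff E.prob (g 0) (g 1) : ℂ) *
    pairCoeff E.prob (g 0) (g 1)) he
    (τ := 1) (σ := 1) (by simp) (by simp)
  simp only [swapPairMean, siteCoeff, if_neg h, Equiv.swap_mul_self]
  refine Eq.trans h1 ?_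
  rw [permExp, sum_fin_two_fun]
  simp [squareMean, Fin.prod_univ_two, sq]

/-- Two swaps with one common register compose to a three-cycle. -/
lemma swapPairMean_of_eq (E : Ensemble N d) {s t v : K} (h : s ≠ t) (hs : v ≠ s) (ht : v ≠ t) :
    swapPairMean E s t t v = cycleMean E := by
  have he : Function.Injective ![s, t, v] := by
    intro i j; fin_cases i <;> fin_cases j <;> simp [h, h.symm, hs, ht, hs.symm, ht.symm]
  have h1 := permExp_comp_of_injective E (fun g => (pairCoeff E.prob (g 0) (g 1) : ℂ) *
    pairCoeff E.prob (g 1) (g 2)) he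
    (τ := Equiv.swap t v * Equiv.swap s t) (σ := Equiv.swap 1 2 * Equiv.swap 0 1) (by
      intro i; fin_cases i <;>
        simp [Equiv.swap_apply_def, h, hs, ht, hs.symm]) (by
      intro r hr
      have hs : r ≠ s := fun h' => hr ⟨0, h'.symm⟩
      have ht : r ≠ t := fun h' => hr ⟨1, h'.symm⟩
      have hv : r ≠ v := fun h' => hr ⟨2, h'.symm⟩
      rw [Equiv.Perm.mul_apply, Equiv.swap_apply_of_ne_of_ne hs ht,
        Equiv.swap_apply_of_ne_of_ne ht hv])
  simp only [swapPairMean, siteCoeff, if_neg h, if_neg ht.symm]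
  refine Eq.trans h1 ?_
  rw [permExp, sum_fin_three_fun]
  simp [cycleMean, Fin.prod_univ_three, Equiv.swap_apply_def]

lemma swapPairMean_of_disjoint (E : Ensemble N d) {s t u v : K} (h : s ≠ t) (hus : u ≠ s)
    (hut : u ≠ t) (hvs : v ≠ s) (hvt : v ≠ t) (huv : u ≠ v) :
    swapPairMean E s t u v = swapMean E ^ 2 := by
  have he : Function.Injective ![s, t, u, v] := by
    intro i j; fin_cases i <;> fin_cases j <;> simp [h, h.symm, hus, hus.symm, hut, hut.symm,
      hvs, hvs.symm, hvt, hvt.symm, huv, huv.symm]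
  have h1 := permExp_comp_of_injective E (fun g => (pairCoeff E.prob (g 0) (g 1) : ℂ) *
    pairCoeff E.prob (g 2) (g 3)) he
    (τ := Equiv.swap u v * Equiv.swap s t) (σ := Equiv.swap 2 3 * Equiv.swap 0 1) (by
      intro i; fin_cases i <;>
        simp [Equiv.swap_apply_def, hus, hus.symm, hut, hut.symm,
          hvs, hvs.symm, hvt, hvt.symm]) (by
      intro r hr
      have hs : r ≠ s := fun h' => hr ⟨0, h'.symm⟩
      have ht : r ≠ t := fun h' => hr ⟨1, h'.symm⟩
      have hu : r ≠ u := fun h' => hr ⟨2, h'.symm⟩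
      have hv : r ≠ v := fun h' => hr ⟨3, h'.symm⟩
      rw [Equiv.Perm.mul_apply, Equiv.swap_apply_of_ne_of_ne hs ht,
        Equiv.swap_apply_of_ne_of_ne hu hv])
  simp only [swapPairMean, siteCoeff, if_neg h, if_neg huv]
  refine Eq.trans h1 ?_
  rw [permExp, sum_fin_four_fun]
  rw [sq, swapMean]
  simp only [Finset.sum_mul]
  simp only [Finset.mul_sum]
  refine Finset.sum_congr rfl fun a _ => Finset.sum_congr rfl fun b _ =>
    Finset.sum_congr rfl fun c _ => Finset.sum_congr rfl fun f _ => ?_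
  simp [Fin.prod_univ_four, Equiv.swap_apply_def]
  ring

/-- Of the ordered pairs `(u, v)`, two coincide with `{s, t}`, `4 (|K| - 2)` share exactly one
register with it, and `(|K| - 2) (|K| - 3)` are disjoint from it; pairs with `u = v` contribute
zero. -/
lemma sum_sum_swapPairMean (E : Ensemble N d) {s t : K} (h : s ≠ t) :
    ∑ u, ∑ v, swapPairMean E s t u v = 2 * squareMean E +
      4 * ((Fintype.card K : ℂ) - 2) * cycleMean E +
      ((Fintype.card K : ℂ) - 2) * ((Fintype.card K : ℂ) - 3) * swapMean E ^ 2 := by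
  let T : Finset K := (Finset.univ.erase s).erase t
  have hT : ∀ {x}, x ∈ T → x ≠ s ∧ x ≠ t := fun {x} hx => by
    simp only [T, Finset.mem_erase] at hx
    exact ⟨hx.2.1, hx.1⟩
  have split : ∀ f : K → ℂ, ∑ x, f x = f s + (f t + ∑ x ∈ T, f x) := fun f => by
    rw [← Finset.add_sum_erase _ _ (Finset.mem_univ s),
      ← Finset.add_sum_erase _ _ (Finset.mem_erase.mpr ⟨h.symm, Finset.mem_univ t⟩)]
  have hcard : (T.card : ℂ) = (Fintype.card K : ℂ) - 2 := by
    have := split fun _ => 1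
    simp only [Finset.sum_const, Finset.card_univ, nsmul_eq_mul, mul_one] at this
    rw [this]; ring
  have hs : ∑ v, swapPairMean E s t s v = squareMean E + T.card * cycleMean E := by
    rw [split, swapPairMean_self_right, swapPairMean_of_eq_eq E h,
      Finset.sum_congr rfl fun v hv => (swapPairMean_comm_left E s t s v).trans
        (swapPairMean_of_eq E h.symm (hT hv).2 (hT hv).1), Finset.sum_const, nsmul_eq_mul]
    ring
  have ht : ∑ v, swapPairMean E s t t v = squareMean E + T.card * cycleMean E := by
    rw [split, swapPairMean_self_right, swapPairMean_comm_right, swapPairMean_of_eq_eq E h,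
      Finset.sum_congr rfl fun v hv => swapPairMean_of_eq E h (hT hv).1 (hT hv).2,
      Finset.sum_const, nsmul_eq_mul]
    ring
  have hu : ∀ u ∈ T, ∑ v, swapPairMean E s t u v =
      2 * cycleMean E + ((T.card : ℂ) - 1) * swapMean E ^ 2 := by
    intro u hu
    rw [split, swapPairMean_comm_right, swapPairMean_comm_left,
      swapPairMean_of_eq E h.symm (hT hu).2 (hT hu).1, swapPairMean_comm_right E s t u t,
      swapPairMean_of_eq E h (hT hu).1 (hT hu).2, ← Finset.add_sum_erase _ _ hu,
      swapPairMean_self_right, Finset.sum_congr rfl fun v hv => swapPairMean_of_disjoint E h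
        (hT hu).1 (hT hu).2 (hT (Finset.mem_of_mem_erase hv)).1
        (hT (Finset.mem_of_mem_erase hv)).2 (Finset.ne_of_mem_erase hv).symm, Finset.sum_const,
      nsmul_eq_mul, Finset.card_erase_of_mem hu, Nat.cast_sub (Finset.card_pos.mpr ⟨u, hu⟩)]
    push_cast
    ring
  rw [split, hs, ht, Finset.sum_congr rfl hu, Finset.sum_const, nsmul_eq_mul, hcard]
  ring

lemma sum_sum_of_ne (f : K → K → ℂ) (c : ℂ) (h0 : ∀ s, f s s = 0) (h : ∀ s t, s ≠ t → f s t = c) :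
    ∑ s, ∑ t, f s t = (Fintype.card K : ℂ) * ((Fintype.card K : ℂ) - 1) * c := by
  have hs : ∀ s, ∑ t, f s t = ((Fintype.card K : ℂ) - 1) * c := fun s => by
    have : ∀ t, f s t = c - if s = t then c else 0 := fun t => by
      split_ifs with hst
      · rw [← hst, h0, sub_self]
      · rw [h s t hst, sub_zero]
    simp only [this, Finset.sum_sub_distrib, Finset.sum_const, Finset.sum_ite_eq,
      Finset.mem_univ, if_true, Finset.card_univ, nsmul_eq_mul]
    ring
  simp only [hs, Finset.sum_const, Finset.card_univ, nsmul_eq_mul]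
  ring

end Patterns

lemma sum_labels_labelMean (E : Ensemble N d) (M : ℕ) :
    ∑ g : Fin M → Fin N, (∏ s, (E.prob (g s) : ℂ)) * labelMean E g =
      M * ((M : ℂ) - 1) * swapMean E := by
  simp only [labelMean, Finset.mul_sum]
  rw [Finset.sum_comm]
  have hc : ∀ s t : Fin M, ∑ g : Fin M → Fin N, (∏ s, (E.prob (g s) : ℂ)) *
      ((siteCoeff E.prob g s t : ℂ) * permTrace E g (Equiv.swap s t)) =
      permExp E (fun g => (siteCoeff E.prob g s t : ℂ)) (Equiv.swap s t) := fun s t =>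
    sum_labels_eq_permExp E (fun g => (siteCoeff E.prob g s t : ℂ)) _
  rw [Finset.sum_congr rfl fun s _ => Finset.sum_comm]
  simp only [hc]
  rw [sum_sum_of_ne _ (swapMean E) (fun s => by simp [siteCoeff, permExp])
    (fun s t h => permExp_swap E h), Fintype.card_fin]

lemma sum_labels_labelSecond (E : Ensemble N d) (M : ℕ) :
    ∑ g : Fin M → Fin N, (∏ s, (E.prob (g s) : ℂ)) * labelSecond E g =
      M * ((M : ℂ) - 1) * (2 * squareMean E + 4 * ((M : ℂ) - 2) * cycleMean E +
        ((M : ℂ) - 2) * ((M : ℂ) - 3) * swapMean E ^ 2) := by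
  have hc : ∀ s t u v : Fin M, ∑ g : Fin M → Fin N, (∏ s, (E.prob (g s) : ℂ)) *
      ((siteCoeff E.prob g s t : ℂ) * siteCoeff E.prob g u v *
        permTrace E g (Equiv.swap u v * Equiv.swap s t)) = swapPairMean E s t u v :=
    fun s t u v => sum_labels_eq_permExp E
      (fun g => (siteCoeff E.prob g s t : ℂ) * siteCoeff E.prob g u v) _
  have h1 : ∑ g : Fin M → Fin N, (∏ s, (E.prob (g s) : ℂ)) * labelSecond E g =
      ∑ s : Fin M, ∑ t, ∑ u, ∑ v, swapPairMean E s t u v := by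
    simp only [← hc, labelSecond, Finset.mul_sum]
    rw [Finset.sum_comm]
    refine Finset.sum_congr rfl fun s _ => ?_
    rw [Finset.sum_comm]
    refine Finset.sum_congr rfl fun t _ => ?_
    rw [Finset.sum_comm]
    exact Finset.sum_congr rfl fun u _ => Finset.sum_comm
  rw [h1, sum_sum_of_ne (fun s t : Fin M => ∑ u, ∑ v, swapPairMean E s t u v) _
    (fun s => by simp only [swapPairMean_self_left, Finset.sum_const_zero])
    (fun s t h => sum_sum_swapPairMean E h), Fintype.card_fin]

end IdentityTest

/-! ### Poisson moments and evaluation of the pattern means -/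

namespace IdentityTest

variable {N d : ℕ}

/-- The factorial moments of the Poisson distribution. -/
lemma hasSum_poi_mul_descFactorial (μ : ℝ) (k : ℕ) :
    HasSum (fun M => poi μ M * (M.descFactorial k : ℝ)) (μ ^ k) := by
  have h0 : ∑ M ∈ Finset.range k, poi μ M * (M.descFactorial k : ℝ) = 0 :=
    Finset.sum_eq_zero fun M hM => by
      rw [Nat.descFactorial_eq_zero_iff_lt.mpr (Finset.mem_range.mp hM), Nat.cast_zero, mul_zero]
  -- The terms with `M < k` vanish; the shifted series is the exponential series times `e^{-μ} μ^k`.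
  rw [← add_zero (μ ^ k), ← h0, ← hasSum_nat_add_iff]
  have hexp : HasSum (fun M : ℕ => μ ^ M / (M ! : ℝ)) (Real.exp μ) := by
    rw [Real.exp_eq_exp_ℝ]
    exact NormedSpace.expSeries_div_hasSum_exp μ
  convert! hexp.mul_left (Real.exp (-μ) * μ ^ k) using 1
  · funext M
    have h : (M ! : ℝ) * ((M + k).descFactorial k : ℝ) = ((M + k)! : ℝ) := by
      have := Nat.factorial_mul_descFactorial (Nat.le_add_left k M)
      rw [Nat.add_sub_cancel] at this
      exact_mod_cast this
    have hM : (M ! : ℝ) ≠ 0 := by positivity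
    have hMk : ((M + k)! : ℝ) ≠ 0 := by positivity
    rw [poi, pow_add, div_mul_eq_mul_div, mul_div_assoc', div_eq_div_iff hMk hM, ← h]
    ring
  · rw [mul_right_comm, ← Real.exp_add, neg_add_cancel, Real.exp_zero, one_mul]

lemma cast_descFactorial_succ (M k : ℕ) :
    (M.descFactorial (k + 1) : ℝ) = ((M : ℝ) - k) * M.descFactorial k := by
  rw [Nat.descFactorial_succ]
  rcases le_or_gt k M with h | h
  · rw [Nat.cast_mul, Nat.cast_sub h]
  · rw [Nat.descFactorial_eq_zero_iff_lt.mpr h]; simp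

/-- The average state. -/
noncomputable def avgState (E : Ensemble N d) : Matrix (Fin d) (Fin d) ℂ :=
  ∑ i, (E.prob i : ℂ) • E.state i

/-- This is why the coefficient is `δ_{ij} / p_i - 1`: averaging over one label centers the state of
the other. -/
lemma sum_pairCoeff_smul_state (E : Ensemble N d) (j : Fin N) :
    ∑ i, ((pairCoeff E.prob i j : ℂ) * E.prob i) • E.state i = E.state j - avgState E := by
  have h : ∀ i, ((pairCoeff E.prob i j : ℂ) * E.prob i) • E.state i =
      (if i = j then E.state i else 0) - (E.prob i : ℂ) • E.state i := fun i => by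
    have := (E.prob_pos i).ne'
    rw [pairCoeff]
    split_ifs
    · rw [← Complex.ofReal_mul, sub_mul, inv_mul_cancel₀ this]
      push_cast
      rw [sub_smul, one_smul, one_mul]
    · push_cast
      rw [zero_sub, neg_one_mul, neg_smul, zero_sub]
  simp only [h, Finset.sum_sub_distrib, Finset.sum_ite_eq', Finset.mem_univ, if_true, avgState]

lemma swapMean_eq_sum_trace (E : Ensemble N d) : swapMean E =
    ∑ i, ∑ j, ((pairCoeff E.prob i j : ℂ) * E.prob i * E.prob j) *
      (E.state i * E.state j).trace := by
  simp only [swapMean, Fintype.sum_prod_type, jointEntry, Matrix.trace, Matrix.diag_apply,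
    Matrix.mul_apply, Finset.mul_sum]
  refine Finset.sum_congr rfl fun i _ => ?_
  rw [Finset.sum_comm]
  refine Finset.sum_congr rfl fun j _ => Finset.sum_congr rfl fun x _ =>
    Finset.sum_congr rfl fun y _ => ?_
  ring

/-- Summing over one label centers one factor. The other may be centered for free, since the
deviations `ρ_j - ρ̄` average to zero. -/
lemma swapMean_eq (E : Ensemble N d) : swapMean E =
    ∑ j, (E.prob j : ℂ) * ((E.state j - avgState E) * (E.state j - avgState E)).trace := by
  have h0 : ∑ j, (E.prob j : ℂ) * ((E.state j - avgState E) * avgState E).trace = 0 := by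
    have h : ∑ j, (E.prob j : ℂ) • (E.state j - avgState E) = 0 := by
      simp only [smul_sub, Finset.sum_sub_distrib, ← Finset.sum_smul, ← Complex.ofReal_sum,
        E.prob_sum, Complex.ofReal_one, one_smul]
      exact sub_self _
    have h' := congrArg (fun A => (A * avgState E).trace) h
    simpa only [Matrix.sum_mul, Matrix.smul_mul, Matrix.trace_sum, Matrix.trace_smul, smul_eq_mul,
      Matrix.zero_mul, Matrix.trace_zero] using h'
  have h1 : ∀ j, (E.prob j : ℂ) * ((E.state j - avgState E) * (E.state j - avgState E)).trace =
      (E.prob j : ℂ) * ((E.state j - avgState E) * E.state j).trace -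
        (E.prob j : ℂ) * ((E.state j - avgState E) * avgState E).trace := fun j => by
    rw [Matrix.mul_sub (E.state j - avgState E), Matrix.trace_sub, mul_sub]
  simp only [h1, Finset.sum_sub_distrib, h0, sub_zero]
  rw [swapMean_eq_sum_trace, Finset.sum_comm]
  refine Finset.sum_congr rfl fun j _ => ?_
  rw [← sum_pairCoeff_smul_state]
  simp only [Matrix.sum_mul, Matrix.smul_mul, Matrix.trace_sum, Matrix.trace_smul, smul_eq_mul,
    Finset.mul_sum]
  exact Finset.sum_congr rfl fun i _ => by ring

/-- The label `j` of the shared register is kept; summing over the two outer labels produces one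
centered factor each. -/
lemma cycleMean_eq (E : Ensemble N d) : cycleMean E =
    ∑ j, (E.prob j : ℂ) *
      (E.state j * ((E.state j - avgState E) * (E.state j - avgState E))).trace := by
  have h1 : cycleMean E = ∑ i, ∑ j, ∑ k, ((pairCoeff E.prob i j : ℂ) * pairCoeff E.prob j k *
      (E.prob i * E.prob j * E.prob k)) * (E.state i * E.state k * E.state j).trace := by
    simp only [cycleMean, Fintype.sum_prod_type, jointEntry, Matrix.trace, Matrix.diag_apply,
      Matrix.mul_apply, Finset.mul_sum, Finset.sum_mul]
    refine Finset.sum_congr rfl fun i _ => ?_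
    rw [Finset.sum_comm]
    refine Finset.sum_congr rfl fun j _ => ?_
    rw [Finset.sum_congr rfl fun x _ => Finset.sum_comm, Finset.sum_comm]
    refine Finset.sum_congr rfl fun k _ => Finset.sum_congr rfl fun x _ =>
      Finset.sum_congr rfl fun y _ => Finset.sum_congr rfl fun z _ => ?_
    ring
  rw [h1, Finset.sum_comm]
  refine Finset.sum_congr rfl fun j _ => ?_
  rw [Matrix.trace_mul_comm, ← sum_pairCoeff_smul_state]
  simp only [Matrix.sum_mul, Matrix.smul_mul, Matrix.mul_smul, Matrix.trace_sum, Matrix.trace_smul,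
    smul_eq_mul, Finset.mul_sum]
  rw [Finset.sum_comm]
  refine Finset.sum_congr rfl fun i _ => Finset.sum_congr rfl fun k _ => ?_
  rw [pairCoeff_comm E.prob j]
  ring

/-- The eigenvalues of `A` are nonnegative with sum one, hence at most one; both traces are compared
in an eigenbasis of `A`. -/
lemma trace_mul_re_le {n : Type*} [Fintype n] [DecidableEq n] {A X : Matrix n n ℂ}
    (hA : A.PosSemidef) (hA1 : A.trace = 1) (hX : X.PosSemidef) :
    (A * X).trace.re ≤ X.trace.re := by
  have h0 := trace_pow_mul_eq_sum hA.isHermitian X 0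
  have h1 := trace_pow_mul_eq_sum hA.isHermitian X 1
  simp only [pow_zero, one_mul, pow_one] at h0 h1
  rw [h0, h1]
  refine Finset.sum_le_sum fun i _ => ?_
  have hle : hA.isHermitian.eigenvalues i ≤ 1 := by
    have hs : ∑ i, hA.isHermitian.eigenvalues i = 1 := by
      have := hA.isHermitian.trace_eq_sum_eigenvalues
      rw [hA1] at this
      exact Complex.ofReal_injective (by push_cast; exact this.symm)
    rw [← hs]
    exact Finset.single_le_sum (f := hA.isHermitian.eigenvalues)
      (fun j _ => hA.eigenvalues_nonneg j) (Finset.mem_univ i)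
  exact mul_le_of_le_one_left (eigenWeight_nonneg hA.isHermitian hX i) hle

lemma state_sub_avgState_isHermitian (E : Ensemble N d) (j : Fin N) :
    (E.state j - avgState E).IsHermitian := by
  have h : (avgState E).IsHermitian := by
    rw [avgState, Matrix.IsHermitian, Matrix.conjTranspose_sum]
    refine Finset.sum_congr rfl fun i _ => ?_
    rw [Matrix.conjTranspose_smul, (E.state_posSemidef i).isHermitian.eq]
    simp
  exact (E.state_posSemidef j).isHermitian.sub h

lemma cycleMean_re_le (E : Ensemble N d) : (cycleMean E).re ≤ (swapMean E).re := by
  rw [cycleMean_eq, swapMean_eq, Complex.re_sum, Complex.re_sum]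
  refine Finset.sum_le_sum fun j _ => ?_
  rw [Complex.re_ofReal_mul, Complex.re_ofReal_mul]
  refine mul_le_mul_of_nonneg_left (trace_mul_re_le (E.state_posSemidef j) (E.state_trace j) ?_)
    (E.prob_pos j).le
  have h := Matrix.posSemidef_conjTranspose_mul_self (E.state j - avgState E)
  rwa [(state_sub_avgState_isHermitian E j).eq] at h

/-- The states enter only through their unit traces. What remains is `∑ p_i p_j (δ_{ij} / p_i - 1)²
= ∑ (1 - 2 p_i) + 1`. -/
lemma squareMean_eq (E : Ensemble N d) : squareMean E = (N : ℂ) - 1 := by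
  have hdiag : ∀ i, ∑ x, jointEntry E (i, x) (i, x) = E.prob i := fun i => by
    have := E.state_trace i
    simp only [Matrix.trace, Matrix.diag_apply] at this
    simp only [jointEntry, ← Finset.mul_sum, this, mul_one]
  have h1 : squareMean E =
      ∑ i, ∑ j, (pairCoeff E.prob i j : ℂ) ^ 2 * (E.prob i * E.prob j) := by
    simp only [squareMean, Fintype.sum_prod_type, ← hdiag, Finset.sum_mul, Finset.mul_sum]
    refine Finset.sum_congr rfl fun i _ => ?_
    rw [Finset.sum_comm]
    exact Finset.sum_congr rfl fun j _ => Finset.sum_comm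
  have h2 : ∀ i j, (pairCoeff E.prob i j : ℂ) ^ 2 * (E.prob i * E.prob j) =
      (if i = j then 1 - 2 * (E.prob i : ℂ) else 0) + E.prob i * E.prob j := fun i j => by
    have : (E.prob i : ℂ) ≠ 0 := by exact_mod_cast (E.prob_pos i).ne'
    rw [pairCoeff]
    split_ifs with hij
    · subst hij
      push_cast
      field_simp
      ring
    · push_cast
      ring
  have hs : ∑ i, (E.prob i : ℂ) = 1 := by exact_mod_cast E.prob_sum
  simp only [h1, h2, Finset.sum_add_distrib, Finset.sum_ite_eq, Finset.mem_univ, if_true,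
    Finset.sum_sub_distrib, ← Finset.mul_sum, hs, Finset.sum_const, Finset.card_univ,
    Fintype.card_fin, nsmul_eq_mul, mul_one]
  ring

lemma hsDist_sq (A B : Matrix (Fin d) (Fin d) ℂ) :
    hsDist A B ^ 2 = (((A - B)ᴴ * (A - B)).trace).re :=
  Real.sq_sqrt (Complex.nonneg_iff.mp
    (Matrix.posSemidef_conjTranspose_mul_self (A - B)).trace_nonneg).1

lemma meanHS_sq (E : Ensemble N d) : meanHS E ^ 2 = 2 * (swapMean E).re := by
  rw [meanHS, Real.sq_sqrt (Finset.sum_nonneg fun i _ => Finset.sum_nonneg fun j _ =>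
    mul_nonneg (mul_nonneg (E.prob_pos i).le (E.prob_pos j).le) (sq_nonneg _)),
    swapMean_eq_sum_trace]
  have hp : ∀ i, E.prob i ≠ 0 := fun i => (E.prob_pos i).ne'
  let t : Fin N → Fin N → ℝ := fun i j => ((E.state i * E.state j).trace).re
  have ht : ∀ i j, t i j = t j i := fun i j =>
    congrArg Complex.re (Matrix.trace_mul_comm _ _)
  have h1 : ∀ i j, hsDist (E.state i) (E.state j) ^ 2 = t i i + t j j - 2 * t i j := fun i j => by
    rw [hsDist_sq, ((E.state_posSemidef i).isHermitian.sub (E.state_posSemidef j).isHermitian).eq,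
      Matrix.sub_mul, Matrix.mul_sub, Matrix.mul_sub]
    simp only [Matrix.trace_sub, Complex.sub_re]
    have := ht i j
    simp only [t] at this ⊢
    rw [← this]
    ring
  have h2 : ∀ i j, ((pairCoeff E.prob i j : ℂ) * E.prob i * E.prob j *
      (E.state i * E.state j).trace).re =
      (if i = j then E.prob i * t i i else 0) - E.prob i * E.prob j * t i j := fun i j => by
    rw [← Complex.ofReal_mul, ← Complex.ofReal_mul, Complex.re_ofReal_mul, pairCoeff]
    split_ifs with hij
    · subst hij
      have := hp i
      simp only [t]
      field_simp
    · simp only [t]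
      ring
  have h3 : ∀ i j, E.prob i * E.prob j * (t i i + t j j - 2 * t i j) =
      (E.prob i * t i i) * E.prob j + E.prob i * (E.prob j * t j j) -
        2 * (E.prob i * E.prob j * t i j) := fun i j => by ring
  simp only [Complex.re_sum, h1, h2, h3, Finset.sum_add_distrib, Finset.sum_sub_distrib,
    ← Finset.mul_sum, ← Finset.sum_mul, E.prob_sum, Finset.sum_ite_eq, Finset.mem_univ, if_true]
  ring

lemma trace_sampleState (E : Ensemble N d) (M : ℕ) : (sampleState E M).trace = 1 := by
  have h := trace_sampleObs_pow_mul_eq_sum_labels E (μ := 1) (M := M) (k := 0) (c := 1)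
    (fun g => permTrace E g 1) (fun g e => by rw [permTrace_comp_equiv]; congr 1; ext; simp)
    (fun m => by
      have h := trace_permOp_mul_productState E (1 : Equiv.Perm (Site m))
      have h1 : permOp d (1 : Equiv.Perm (Site m)) = 1 := by
        ext x y
        simp [permOp, Matrix.one_apply]
      rw [h1] at h
      rw [pow_zero, h, one_mul])
  have h1 := sum_labels_eq_permExp E (fun _ : Fin M → Fin N => 1) 1
  -- With the identity permutation every register can be traced out, leaving the empty product.
  have h2 := permExp_comp_of_injective E (fun _ : Fin 0 → Fin N => 1)
    (e := (Fin.elim0 : Fin 0 → Fin M)) (fun i => i.elim0) (τ := 1) (σ := 1) (by simp) (by simp)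
  simp only [one_mul] at h1
  rw [pow_zero, one_mul] at h
  rw [h, one_mul, h1, h2]
  simp [permExp]

lemma trace_sampleObs_mul (E : Ensemble N d) {μ : ℝ} (hμ : 0 < μ) (M : ℕ) :
    (sampleObs d E.prob μ M * sampleState E M).trace =
      (2 / μ ^ 2 : ℝ) * (M * ((M : ℂ) - 1) * swapMean E) := by
  have h := trace_sampleObs_pow_mul_eq_sum_labels E (μ := μ) (M := M) (k := 1)
    (c := (2 / μ ^ 2 : ℝ)) (fun g => labelMean E g) (fun g e => labelMean_comp_equiv E g e)
    (fun m => by rw [pow_one, trace_typeObs_mul E hμ])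
  rwa [pow_one, sum_labels_labelMean] at h

lemma trace_sampleObs_sq_mul (E : Ensemble N d) {μ : ℝ} (hμ : 0 < μ) (M : ℕ) :
    (sampleObs d E.prob μ M ^ 2 * sampleState E M).trace =
      (2 / μ ^ 2 : ℝ) ^ 2 * (M * ((M : ℂ) - 1) * (2 * squareMean E +
        4 * ((M : ℂ) - 2) * cycleMean E + ((M : ℂ) - 2) * ((M : ℂ) - 3) * swapMean E ^ 2)) := by
  have h := trace_sampleObs_pow_mul_eq_sum_labels E (μ := μ) (M := M) (k := 2)
    (c := (2 / μ ^ 2 : ℝ) ^ 2) (fun g => labelSecond E g) (fun g e => labelSecond_comp_equiv E g e)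
    (fun m => trace_typeObs_sq_mul E hμ)
  rwa [sum_labels_labelSecond] at h

/-! ### Moments of the Poissonized estimator and the variance bound -/

lemma hasSum_first_moment (E : Ensemble N d) {μ : ℝ} (hμ : 0 < μ) :
    HasSum (fun M => poi μ M * (sampleObs d E.prob μ M * sampleState E M).trace.re)
      (2 * (swapMean E).re) := by
  have h := (hasSum_poi_mul_descFactorial μ 2).mul_left (2 / μ ^ 2 * (swapMean E).re)
  convert! h using 1
  · funext M
    have : (M : ℂ) * ((M : ℂ) - 1) * swapMean E = ((M * (M - 1) : ℝ) : ℂ) * swapMean E := by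
      push_cast; ring
    rw [trace_sampleObs_mul E hμ, this, Complex.re_ofReal_mul, Complex.re_ofReal_mul]
    simp only [cast_descFactorial_succ, Nat.descFactorial_zero]
    push_cast
    ring
  · field_simp

lemma hasSum_second_moment (E : Ensemble N d) {μ : ℝ} (hμ : 0 < μ) :
    HasSum (fun M => poi μ M * (sampleObs d E.prob μ M ^ 2 * sampleState E M).trace.re)
      (4 * (swapMean E ^ 2).re + 16 * (cycleMean E).re / μ + 8 * ((N : ℝ) - 1) / μ ^ 2) := by
  have h4 := (hasSum_poi_mul_descFactorial μ 4).mul_left ((2 / μ ^ 2) ^ 2 * (swapMean E ^ 2).re)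
  have h3 := (hasSum_poi_mul_descFactorial μ 3).mul_left
    ((2 / μ ^ 2) ^ 2 * (4 * (cycleMean E).re))
  have h2 := (hasSum_poi_mul_descFactorial μ 2).mul_left ((2 / μ ^ 2) ^ 2 * (2 * ((N : ℝ) - 1)))
  convert! (h4.add h3).add h2 using 1
  · funext M
    have : (((2 / μ ^ 2 : ℝ) : ℂ) ^ 2 * (M * ((M : ℂ) - 1) * (2 * squareMean E +
        4 * ((M : ℂ) - 2) * cycleMean E + ((M : ℂ) - 2) * ((M : ℂ) - 3) * swapMean E ^ 2))) =
        (((2 / μ ^ 2) ^ 2 * (M * (M - 1)) * (2 * (N - 1)) : ℝ) : ℂ) +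
        (((2 / μ ^ 2) ^ 2 * (M * (M - 1)) * (4 * (M - 2)) : ℝ) : ℂ) * cycleMean E +
        (((2 / μ ^ 2) ^ 2 * (M * (M - 1)) * ((M - 2) * (M - 3)) : ℝ) : ℂ) * swapMean E ^ 2 := by
      rw [squareMean_eq]
      push_cast
      ring
    rw [trace_sampleObs_sq_mul E hμ, this, Complex.add_re, Complex.add_re, Complex.re_ofReal_mul,
      Complex.re_ofReal_mul, Complex.ofReal_re]
    simp only [cast_descFactorial_succ, Nat.descFactorial_zero]
    push_cast
    ring
  · field_simp
    ring

end IdentityTest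

theorem mainTheorem5 :
    ∃ C : ℝ, 0 < C ∧ ∀ (N d : ℕ) (E : IdentityTest.Ensemble N d) (μ : ℝ), 0 < μ →
      Summable (fun X : IdentityTest.outcomes E μ => (X : ℝ) * IdentityTest.outProb E μ X) ∧
      Summable (fun X : IdentityTest.outcomes E μ =>
        IdentityTest.outProb E μ X * ((X : ℝ) - IdentityTest.estMean E μ) ^ 2) ∧
      IdentityTest.estVar E μ ≤
        C * ((N : ℝ) / μ ^ 2) + 16 * IdentityTest.meanHS E ^ 2 / μ := by
  -- The constant comes from the coincident pairs, whose contribution is `8 (N - 1) / μ²`.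
  refine ⟨8, by norm_num, fun N d E μ hμ => ?_⟩
  have h0 : HasSum (fun M => IdentityTest.poi μ M * (IdentityTest.sampleState E M).trace.re) 1 := by
    simpa [IdentityTest.trace_sampleState] using IdentityTest.hasSum_poi_mul_descFactorial μ 0
  obtain ⟨h1, h2, h3⟩ := IdentityTest.estimator_of_moments E hμ
    (fun M => IdentityTest.sampleObs_isHermitian E hμ M)
    (fun M => IdentityTest.sampleState_posSemidef E M) h0
    (IdentityTest.hasSum_first_moment E hμ) (IdentityTest.hasSum_second_moment E hμ)
  refine ⟨h1, h2, ?_⟩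
  -- This inequality suffices to cancel the squared mean, so `swapMean` need not be shown to be
  -- real.
  have hsq : (IdentityTest.swapMean E ^ 2).re ≤ (IdentityTest.swapMean E).re ^ 2 := by
    rw [sq, Complex.mul_re]
    nlinarith [sq_nonneg (IdentityTest.swapMean E).im]
  have hm := IdentityTest.meanHS_sq E
  -- Since `swapMean` has real part `meanHS² / 2`, a factor of two is given away here.
  have hc : 16 * (IdentityTest.cycleMean E).re / μ ≤ 16 * IdentityTest.meanHS E ^ 2 / μ := by
    have := IdentityTest.cycleMean_re_le E
    have := sq_nonneg (IdentityTest.meanHS E)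
    gcongr
    linarith
  have hN : 8 * ((N : ℝ) - 1) / μ ^ 2 ≤ 8 * (N / μ ^ 2) := by
    rw [← mul_div_assoc]
    gcongr
    linarith
  rw [h3]
  nlinarith
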